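/- Conventions. For a metric space $X$, the isometry group $\mathrm{Iso}(X)$ carries the compact-open topology. For a subgroup $H\le \mathrm{Iso}(X)$, $p\in X$ and a real number $r$, put $H(p,r)=\{h\in H : d(hp,p)\le r\}$. The orbit space $X/H$ has the distance $\inf_{h\in H}d(x,hy)$ between the orbits of $x$ and $y$. For $\epsilon>0$, a pointed $\epsilon$-equivariant Gromov–Hausdorff approximation from $(X,p,H)$ to $(Y,q,K)$ is a triple of maps $f:B_{1/\epsilon}(p)\to B_{1/\epsilon+\epsilon}(q)$, $\phi:H(p,1/\epsilon)\to K(q,1/\epsilon)$, $\psi:K(q,1/\epsilon)\to H(p,1/\epsilon)$ such that (1) $f(p)=q$, the image of $f$ is $2\epsilon$-dense in $B_{1/\epsilon+\epsilon}(q)$, and $|d(f(x_1),f(x_2))-d(x_1,x_2)|\le\epsilon$ for all $x_1,x_2\in B_{1/\epsilon}(p)$; (2) $d(\phi(h)f(x),f(hx))<\epsilon$ for all $h\in H(p,1/\epsilon)$ and all $x\in B_{1/\epsilon}(p)$ with $hx\in B_{1/\epsilon}(p)$; (3) $d(kf(x),f(\psi(k)x))<\epsilon$ for all $k\in K(q,1/\epsilon)$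 and all $x\in B_{1/\epsilon}(p)$ with $\psi(k)x\in B_{1/\epsilon}(p)$. We say that $(X_i,p_i,G_i)$ converges equivariantly to $(X,p,G)$ via maps $f_i$ if for some $\epsilon_i\to0$ and all large $i$ there are $\phi_i,\psi_i$ such that $(f_i,\phi_i,\psi_i)$ is an $\epsilon_i$-equivariant approximation from $(X_i,p_i,G_i)$ to $(X,p,G)$, where $f_i$ is restricted to the ball of radius $1/\epsilon_i$ about $p_i$. Theorem. Let $(X_i,p_i)$, $i\in\mathbb N$, be simply connected proper geodesic pointed metric spaces, let $G_i\le\mathrm{Iso}(X_i)$ be closed subgroups, and let $D$ be such that $\mathrm{diam}(X_i/G_i)<D$ for all $i$. Let $(X,p)$ be a proper geodesic pointed metric space and $G\le\mathrm{Iso}(X)$ a closed subgroup, and suppose that $(X_i,p_i,G_i)$ converges equivariantly to $(X,p,G)$ via maps $f_i$. Let $G'\lhd G$ be a closed normal subgroup such that $G/G'$ is discrete and $G'$ is generated by $G'(p,R)$ for some $R\ge0$. Then there are closed normal subgroups $G_i'\lhd G_i$ such that (a) $G_i'$ converges to $G'$ along with the convergence of $G_i$ to $G$, via the same maps $f_i$: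 for some $\delta_i\to0$ and all large $i$ there are $\phi_i,\psi_i$ such that $(f_i,\phi_i,\psi_i)$ is a $\delta_i$-equivariant approximation from $(X_i,p_i,G_i)$ to $(X,p,G)$ and, with $\phi_i,\psi_i$ restricted, from $(X_i,p_i,G_i')$ to $(X,p,G')$; (b) $G_i/G_i'\cong G/G'$ for all large $i$; (c) there are $\epsilon_i\to0$ such that $G_i'$ is generated by $G_i'(p_i,R+\epsilon_i)$ for every $i$. Moreover, $G/G'$ is finitely presented. -/

import Mathlib

open Set Filter Topology Metric

noncomputable section

/-- The compact-open topology on the isometry group. -/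
instance isometryGroupTopology (X : Type*) [MetricSpace X] : TopologicalSpace (X ≃ᵢ X) :=
  TopologicalSpace.induced (fun g : X ≃ᵢ X => (⟨g, g.continuous⟩ : C(X, X))) inferInstance

/-- Any two points are joined by a curve, parametrised by arc length, whose length is their
distance. -/
def IsGeodesicSpace (X : Type*) [MetricSpace X] : Prop :=
  ∀ x y : X, ∃ γ : ℝ → X, γ 0 = x ∧ γ (dist x y) = y ∧
    ∀ s ∈ Icc (0 : ℝ) (dist x y), ∀ t ∈ Icc (0 : ℝ) (dist x y), dist (γ s) (γ t) = |s - t|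

/-- The set `H(p, r)` of the elements of `H` that move `p` by at most `r`. -/
def displacementBall {X : Type*} [MetricSpace X] (H : Subgroup (X ≃ᵢ X)) (p : X) (r : ℝ) :
    Set (X ≃ᵢ X) :=
  {h | h ∈ H ∧ dist (h p) p ≤ r}

/-- The diameter of the orbit space `X / H`, in which two orbits have the distance
`inf_{h ∈ H} d(x, h y)`. -/
def orbitSpaceDiam {X : Type*} [MetricSpace X] (H : Subgroup (X ≃ᵢ X)) : ENNReal :=
  ⨆ (x : X) (y : X), ⨅ h : H, edist x ((h : X ≃ᵢ X) y)

/-- `(f, φ, ψ)` is a pointed `ε`-equivariant Gromov-Hausdorff approximation from `(X, p, H)` to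
`(Y, q, K)`. The maps are written as total functions; only the values of `f` on the ball of radius
`1 / ε` about `p`, of `φ` on `H(p, 1 / ε)` and of `ψ` on `K(q, 1 / ε)` matter. -/
structure IsEGHApprox {X Y : Type*} [MetricSpace X] [MetricSpace Y] (ε : ℝ)
    (p : X) (H : Subgroup (X ≃ᵢ X)) (q : Y) (K : Subgroup (Y ≃ᵢ Y))
    (f : X → Y) (φ : (X ≃ᵢ X) → (Y ≃ᵢ Y)) (ψ : (Y ≃ᵢ Y) → (X ≃ᵢ X)) : Prop where
  pos : 0 < ε
  mapsTo_f : MapsTo f (ball p (1 / ε)) (ball q (1 / ε + ε))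
  mapsTo_φ : MapsTo φ (displacementBall H p (1 / ε)) (displacementBall K q (1 / ε))
  mapsTo_ψ : MapsTo ψ (displacementBall K q (1 / ε)) (displacementBall H p (1 / ε))
  map_base : f p = q
  dense : ∀ y ∈ ball q (1 / ε + ε), ∃ x ∈ ball p (1 / ε), dist y (f x) ≤ 2 * ε
  distortion : ∀ x₁ ∈ ball p (1 / ε), ∀ x₂ ∈ ball p (1 / ε),
    |dist (f x₁) (f x₂) - dist x₁ x₂| ≤ ε
  equivariant_φ : ∀ h ∈ displacementBall H p (1 / ε), ∀ x ∈ ball p (1 / ε),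
    h x ∈ ball p (1 / ε) → dist (φ h (f x)) (f (h x)) < ε
  equivariant_ψ : ∀ k ∈ displacementBall K q (1 / ε), ∀ x ∈ ball p (1 / ε),
    ψ k x ∈ ball p (1 / ε) → dist (k (f x)) (f (ψ k x)) < ε

/-- `(X i, p i, G i)` converges to `(Y, q, K)` in the pointed equivariant Gromov-Hausdorff sense,
and the maps `f i` realise the convergence: for some `ε i → 0` and for all large `i`, `f i` is the
space component of an `ε i`-equivariant approximation. -/
def EGHConvergesVia {X : ℕ → Type*} [∀ i, MetricSpace (X i)] {Y : Type*} [MetricSpace Y]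
    (p : ∀ i, X i) (G : ∀ i, Subgroup (X i ≃ᵢ X i)) (q : Y) (K : Subgroup (Y ≃ᵢ Y))
    (f : ∀ i, X i → Y) : Prop :=
  ∃ ε : ℕ → ℝ, Tendsto ε atTop (𝓝 0) ∧ ∀ᶠ i in atTop, ∃ φ ψ,
    IsEGHApprox (ε i) (p i) (G i) q K (f i) φ ψ

/-- The convergence of `(X i, p i, G i, N i)` to `(Y, q, K, L)`, where `N i ≤ G i` and `L ≤ K`,
realised by the maps `f i`: the same triples `(f i, φ, ψ)` are approximations for the groups `G i`
and `K` and for their subgroups `N i` and `L`. -/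
def EGHPairConvergesVia {X : ℕ → Type*} [∀ i, MetricSpace (X i)] {Y : Type*} [MetricSpace Y]
    (p : ∀ i, X i) (G N : ∀ i, Subgroup (X i ≃ᵢ X i)) (q : Y) (K L : Subgroup (Y ≃ᵢ Y))
    (f : ∀ i, X i → Y) : Prop :=
  ∃ ε : ℕ → ℝ, Tendsto ε atTop (𝓝 0) ∧ ∀ᶠ i in atTop, ∃ φ ψ,
    IsEGHApprox (ε i) (p i) (G i) q K (f i) φ ψ ∧ IsEGHApprox (ε i) (p i) (N i) q L (f i) φ ψ

end

/-! Write Γ for `K ⧸ K'`. As Γ is discrete, `K'` is open in `K`; as `K` is cobounded and `K'` is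
normal, two elements of `K` that are close on a ball of a fixed radius, wherever it is centred, have
the same class in Γ (`exists_separated`). So for a fine approximation the map sending g to the class
of φ g is multiplicative while displacements stay controlled (`IsFineApprox.classOf_φ_mul`).

A cobounded group of isometries of a simply connected geodesic space is presented by its elements of
bounded displacement: a locally multiplicative map defines a cocycle on the space, and the
associated covering has a section (`exists_coboundary`, `exists_monoidHom_extending`). Hence for
large i the class map extends to a homomorphism ρ from `G i` to Γ. Its kernel is the required
subgroup, and ρ agrees with the class of φ on all displacements up to 1 / ε.

Generation of the kernel rests on a presentation of Γ by the multiplication table of a set T of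
classes. The limit space need not be simply connected, so relations are lifted: equal words in `K`
lift to almost equal words in `G i`, where a map respecting the table extends
(`map_classOf_prod_eq_of_prod_eq`). Since `K'` is generated by elements of trivial class and
displacement at most `R`, this yields the presentation (`exists_tablePresented_mulEquiv`). T is
finite because `Y` is proper, so Γ is finitely presented.

Finally let S be generated by the kernel elements of small displacement. It is normal in `G i`, and
the table relations of Γ hold in the quotient of `G i` by S. This gives a homomorphism from Γ to
that quotient whose composition with ρ is the projection, so S is the whole kernel
(`IsFineApprox.closure_kernelIn_eq`). -/

noncomputable section

/-! ### Cocycles on simply connected geodesic spaces -/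

theorem IsGeodesicSpace.isPathConnected_ball {X : Type*} [MetricSpace X] (hX : IsGeodesicSpace X)
    (x : X) {r : ℝ} (hr : 0 < r) : IsPathConnected (ball x r) := by
  refine ⟨x, mem_ball_self hr, fun {y} hy => ?_⟩
  obtain ⟨γ, h0, h1, hγ⟩ := hX x y
  have hcont : ContinuousOn γ (Icc 0 (dist x y)) := by
    have : LipschitzOnWith 1 γ (Icc 0 (dist x y)) :=
      LipschitzOnWith.of_dist_le_mul fun s hs t ht => by
        simp [hγ s hs t ht, Real.dist_eq]
    exact this.continuousOn
  have hseg : JoinedIn (Icc (0 : ℝ) (dist x y)) 0 (dist x y) :=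
    ((convex_Icc (0 : ℝ) (dist x y)).isPathConnected ⟨0, left_mem_Icc.2 dist_nonneg⟩).joinedIn _
      (left_mem_Icc.2 dist_nonneg) _ (right_mem_Icc.2 dist_nonneg)
  have himg := hseg.map_continuousOn hcont
  rw [h0, h1] at himg
  refine himg.mono ?_
  rintro _ ⟨t, ht, rfl⟩
  have h := hγ t ht 0 (left_mem_Icc.2 dist_nonneg)
  rw [h0, sub_zero, abs_of_nonneg ht.1] at h
  rw [mem_ball, h]
  rw [mem_ball, dist_comm] at hy
  exact ht.2.trans_lt hy

theorem IsGeodesicSpace.locallyPathConnectedSpace {X : Type*} [MetricSpace X]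
    (hX : IsGeodesicSpace X) : LocallyPathConnectedSpace X :=
  .of_bases (fun x => nhds_basis_ball (x := x)) fun x _ hr => hX.isPathConnected_ball x hr

/-- The fibre bundle with discrete fibre `H` glued along a cocycle of scale `1`. -/
def cocycleBundleCore {X H : Type*} [MetricSpace X] [Group H] [TopologicalSpace H]
    [DiscreteTopology H] (a : X → X → H)
    (ha : ∀ x y z, dist x y < 1 → dist y z < 1 → dist x z < 1 → a x y * a y z = a x z) :
    FiberBundleCore X X H where
  baseSet x := ball x (1 / 2)
  isOpen_baseSet _ := isOpen_ball
  indexAt x := x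
  mem_baseSet_at x := mem_ball_self (by norm_num)
  coordChange x y _ v := v * a x y
  coordChange_self x _ _ v := by
    have := ha x x x (by simp) (by simp) (by simp)
    rw [mul_eq_left] at this
    rw [this, mul_one]
  continuousOn_coordChange x y :=
    ((continuous_of_discreteTopology (f := fun v : H => v * a x y)).comp
      continuous_snd).continuousOn
  coordChange_comp x y z w hw v := by
    have hlt : ∀ s t : X, w ∈ ball s (1 / 2) → w ∈ ball t (1 / 2) → dist s t < 1 := by
      intro s t hs ht
      rw [mem_ball, dist_comm] at hs
      rw [mem_ball] at ht
      linarith [dist_triangle s w t]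
    rw [mul_assoc, ha x y z (hlt _ _ hw.1.1 hw.1.2) (hlt _ _ hw.1.2 hw.2) (hlt _ _ hw.1.1 hw.2)]

/-- On a simply connected geodesic space every cocycle of scale `1` is a coboundary. -/
theorem exists_coboundary {X H : Type*} [MetricSpace X] [SimplyConnectedSpace X]
    (hX : IsGeodesicSpace X) [Group H] (a : X → X → H)
    (ha : ∀ x y z, dist x y < 1 → dist y z < 1 → dist x z < 1 → a x y * a y z = a x z) :
    ∃ b : X → H, ∀ x y, dist x y < 1 / 2 → b y = b x * a x y := by
  let _ : TopologicalSpace H := ⊥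
  have : DiscreteTopology H := ⟨rfl⟩
  have := hX.locallyPathConnectedSpace
  let Z := cocycleBundleCore a ha
  have hcov : IsCoveringMap (Bundle.TotalSpace.proj : Bundle.TotalSpace H Z.Fiber → X) :=
    FiberBundle.isCoveringMap
  obtain ⟨x₀⟩ := (inferInstance : Nonempty X)
  -- Simple connectedness and local path connectedness lift the identity map to a global section of
  -- the covering.
  obtain ⟨s, ⟨-, hs⟩, -⟩ := hcov.existsUnique_continuousMap_lifts (ContinuousMap.id X) x₀
    (⟨x₀, (1 : H)⟩ : Bundle.TotalSpace H Z.Fiber) rfl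
  have hs' : ∀ x, (s x).1 = x := fun x => congrFun hs x
  let b : X → H := fun x => (s x).2
  refine ⟨b, fun y x hxy => ?_⟩
  -- Read in the trivialisation centred at `x`, the section has values in a discrete fibre, so it is
  -- constant on the connected ball.
  have hcont : ContinuousOn (fun y => (Z.localTriv x (s y)).2) (ball x (1 / 2)) := by
    refine continuous_snd.comp_continuousOn
      ((Z.localTriv x).continuousOn_toFun.comp s.continuous.continuousOn fun y hy => ?_)
    rw [Z.mem_localTriv_source, hs', ← Z.baseSet_at]
    exact hy
  have hball := (hX.isPathConnected_ball x (by norm_num : (0 : ℝ) < 1 / 2)).isConnected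
  have hconst := hball.isPreconnected.constant hcont (mem_ball_self (by norm_num)) (mem_ball.2 hxy)
  have key : ∀ y, (Z.localTriv x (s y)).2 = b y * a y x := fun y => by
    rw [Z.localTriv_apply]
    change b y * a (s y).1 x = _
    rw [hs']
  rw [key, key] at hconst
  have h1 := ha x x x (by simp) (by simp) (by simp)
  rw [mul_eq_left] at h1
  rw [h1, mul_one] at hconst
  exact hconst

/-! ### Presentations of cobounded isometry groups -/

section Displacement

variable {X : Type*} [MetricSpace X]

theorem IsometryEquiv.dist_inv_mul_apply (u g : X ≃ᵢ X) (x y : X) :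
    dist ((u⁻¹ * g) x) y = dist (g x) (u y) := by
  rw [← u.dist_eq, IsometryEquiv.mul_apply, IsometryEquiv.apply_inv_self]

theorem IsometryEquiv.dist_inv_apply (u : X ≃ᵢ X) (x y : X) :
    dist (u⁻¹ x) y = dist x (u y) := by
  rw [← u.dist_eq, IsometryEquiv.apply_inv_self]

theorem IsometryEquiv.dist_mul_apply_le (g h : X ≃ᵢ X) (p : X) :
    dist ((g * h) p) p ≤ dist (g p) p + dist (h p) p := by
  have := dist_triangle ((g * h) p) (g p) p
  rw [IsometryEquiv.mul_apply, g.dist_eq] at this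
  rw [IsometryEquiv.mul_apply]
  linarith

end Displacement

/-- Steps of length 1/4 lead back to 0. This carries locally constant quantities along geodesics
without any continuity. -/
theorem eq_of_locally_eq_Icc {α : Type*} {F : ℝ → α} {d : ℝ} (hd : 0 ≤ d)
    (hF : ∀ s ∈ Icc 0 d, ∀ t ∈ Icc 0 d, |s - t| < 1 / 2 → F s = F t) : F d = F 0 := by
  have key : ∀ n : ℕ, ∀ t ∈ Icc 0 d, t ≤ n / 4 → F t = F 0 := by
    intro n
    induction n with
    | zero =>
      intro t ht htn
      have : t = 0 := le_antisymm (by simpa using htn) ht.1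
      rw [this]
    | succ n ih =>
      intro t ht htn
      push_cast at htn
      have hs : max 0 (t - 1 / 4) ∈ Icc 0 d :=
        ⟨le_max_left _ _, max_le hd (by linarith [ht.2])⟩
      rw [hF t ht _ hs ?_]
      · exact ih _ hs (max_le (by positivity) (by linarith))
      · rcases max_cases 0 (t - 1 / 4) with ⟨h, h'⟩ | ⟨h, h'⟩ <;> rw [h, abs_lt] <;>
          constructor <;> linarith [ht.1]
  obtain ⟨n, hn⟩ := exists_nat_ge (d * 4)
  exact key n d ⟨hd, le_rfl⟩ (by linarith)

/-- Induction over a cobounded isometry group of a geodesic space: every element is reached from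
elements of small displacement by steps of small displacement, without leaving the displacement
ball that contains it. -/
theorem chain_induction {X : Type*} [MetricSpace X] (hX : IsGeodesicSpace X) {p : X}
    {G : Subgroup (X ≃ᵢ X)} {C : ℝ} (hC : 0 < C) (hcob : ∀ x, ∃ g ∈ G, dist (g p) x < C)
    {r : ℝ} {P : (X ≃ᵢ X) → Prop} (h0 : ∀ g ∈ G, dist (g p) p ≤ 2 * C + 1 → P g)
    (hs : ∀ u ∈ G, ∀ h ∈ G, dist (u p) p ≤ r → dist (h p) p ≤ 2 * C + 1 →
      dist ((u * h) p) p ≤ r → P u → P (u * h)) :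
    ∀ g ∈ G, dist (g p) p ≤ r → P g := by
  have key : ∀ n : ℕ, ∀ g ∈ G, dist (g p) p ≤ r → dist (g p) p ≤ n → P g := by
    intro n
    induction n with
    | zero =>
      intro g hg _ hgn
      exact h0 g hg (hgn.trans (by push_cast; linarith))
    | succ n ih =>
      intro g hg hgr hgn
      push_cast at hgn
      rcases le_or_gt (dist (g p) p) (2 * C + 1) with hle | hlt
      · exact h0 g hg hle
      obtain ⟨γ, hγ0, hγ1, hγ⟩ := hX p (g p)
      rw [dist_comm] at hγ1 hγ
      set a := dist (g p) p with ha
      -- An orbit point within `C` of the geodesic point at distance `C + 1` from `g p` is nearer to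
      -- `p` than `g p` by more than 1 and lies within `2 * C + 1` of `g p`.
      have hz : a - (C + 1) ∈ Icc 0 a := ⟨by linarith, by linarith⟩
      have hz0 := hγ _ hz 0 ⟨le_rfl, by linarith⟩
      have hz1 := hγ _ hz a ⟨by linarith, le_rfl⟩
      rw [hγ0, sub_zero, abs_of_nonneg hz.1] at hz0
      rw [hγ1, abs_of_nonpos (by linarith)] at hz1
      obtain ⟨u, hu, hup⟩ := hcob (γ (a - (C + 1)))
      have hu1 : dist (u p) p < a - 1 := by
        linarith [dist_triangle (u p) (γ (a - (C + 1))) p]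
      have hu2 : dist (u p) (g p) < 2 * C + 1 := by
        linarith [dist_triangle (u p) (γ (a - (C + 1))) (g p)]
      have hP := ih u hu (by linarith) (by linarith)
      have := hs u hu (u⁻¹ * g) (G.mul_mem (G.inv_mem hu) hg) (by linarith)
        (by rw [IsometryEquiv.dist_inv_mul_apply, dist_comm]; exact hu2.le)
        (by rw [mul_inv_cancel_left]; exact hgr) hP
      rwa [mul_inv_cancel_left] at this
  intro g hg hgr
  obtain ⟨n, hn⟩ := exists_nat_ge (dist (g p) p)
  exact key n g hg hgr hn

/-- A cobounded isometry group of a simply connected geodesic space is presented by its elements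
of bounded displacement and their multiplication table: a map into a group that is multiplicative
on elements of bounded displacement extends to a homomorphism. -/
theorem exists_monoidHom_extending {X H : Type*} [MetricSpace X] [SimplyConnectedSpace X]
    (hX : IsGeodesicSpace X) {p : X} {G : Subgroup (X ≃ᵢ X)} {C : ℝ} (hC : 0 < C)
    (hcob : ∀ x, ∃ g ∈ G, dist (g p) x < C) [Group H] {l : ℝ} (hl : 3 * C + 2 ≤ l)
    (τ : (X ≃ᵢ X) → H)
    (hτ : ∀ g ∈ G, ∀ h ∈ G, dist (g p) p ≤ l → dist (h p) p ≤ l → dist ((g * h) p) p ≤ l →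
      τ (g * h) = τ g * τ h) :
    ∃ ρ : G →* H, ∀ g : G, dist ((g : X ≃ᵢ X) p) p ≤ l → ρ g = τ g := by
  choose c hcG hc using hcob
  have hcc : ∀ x y, dist x y < 1 → dist (c y p) (c x p) ≤ 2 * C + 1 := fun x y hxy => by
    have h1 := hc x
    have h2 := hc y
    rw [dist_comm] at hxy
    rw [dist_comm] at h1
    linarith [dist_triangle4 (c y p) y x (c x p)]
  have hτ' : ∀ u ∈ G, ∀ v ∈ G, ∀ w ∈ G, dist (v p) (u p) ≤ l → dist (w p) (v p) ≤ l →
      dist (w p) (u p) ≤ l → τ (u⁻¹ * v) * τ (v⁻¹ * w) = τ (u⁻¹ * w) := by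
    intro u hu v hv w hw huv hvw huw
    have h := hτ (u⁻¹ * v) (G.mul_mem (G.inv_mem hu) hv) (v⁻¹ * w) (G.mul_mem (G.inv_mem hv) hw)
    rw [show u⁻¹ * v * (v⁻¹ * w) = u⁻¹ * w by group] at h
    simp only [IsometryEquiv.dist_inv_mul_apply] at h
    exact (h huv hvw huw).symm
  -- The elements `c x` move `p` near `x`, so the increments between nearby points have displacement
  -- at most `2 * C + 1` and `τ` turns them into a cocycle.
  obtain ⟨b, hb⟩ := exists_coboundary hX (fun x y => τ ((c x)⁻¹ * c y)) fun x y z hxy hyz hxz =>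
    hτ' _ (hcG x) _ (hcG y) _ (hcG z) (by linarith [hcc x y hxy]) (by linarith [hcc y z hyz])
      (by linarith [hcc x z hxz])
  have hloc : ∀ g ∈ G, ∀ x y, dist x y < 1 / 2 → dist (g p) (c x p) ≤ l →
      dist (g p) (c y p) ≤ l → b x * τ ((c x)⁻¹ * g) = b y * τ ((c y)⁻¹ * g) := by
    intro g hg x y hxy hx hy
    rw [hb x y hxy, mul_assoc, hτ' _ (hcG x) _ (hcG y) _ hg _ hy hx]
    linarith [hcc x y (by linarith)]
  -- By `hloc`, the expression `b x * τ ((c x)⁻¹ * g)` does not change under small moves of `x` near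
  -- `g p`; `B g` is its value at `x = g p`.
  let B : (X ≃ᵢ X) → H := fun g => b (g p) * τ ((c (g p))⁻¹ * g)
  have hstep : ∀ g ∈ G, ∀ s ∈ G, dist (s p) p ≤ 2 * C + 1 → B (g * s) = B g * τ s := by
    intro g hg s hs hsp
    have hgs : dist (g p) ((g * s) p) = dist (s p) p := by
      rw [IsometryEquiv.mul_apply, g.dist_eq, dist_comm]
    obtain ⟨γ, hγ0, hγ1, hγ⟩ := hX (g p) ((g * s) p)
    rw [hgs] at hγ1 hγ
    -- The geodesic has length at most `2 * C + 1` and each point is `C`-close to its orbit point,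
    -- so `3 * C + 1` bounds the distance.
    have hfar : ∀ t ∈ Icc 0 (dist (s p) p), dist (g p) (c (γ t) p) ≤ l := by
      intro t ht
      have h := hγ 0 ⟨le_rfl, ht.1.trans ht.2⟩ t ht
      rw [hγ0, zero_sub, abs_neg, abs_of_nonneg ht.1] at h
      have h2 := hc (γ t)
      rw [dist_comm] at h2
      linarith [dist_triangle (g p) (γ t) (c (γ t) p), ht.2]
    have hseg := eq_of_locally_eq_Icc (F := fun t => b (γ t) * τ ((c (γ t))⁻¹ * g))
      (d := dist (s p) p) dist_nonneg fun t ht t' ht' htt' =>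
        hloc g hg _ _ (by rwa [hγ t ht t' ht']) (hfar t ht) (hfar t' ht')
    simp only [hγ0, hγ1] at hseg
    have hend := hfar _ (right_mem_Icc.2 dist_nonneg)
    rw [hγ1] at hend
    have hc' := hc ((g * s) p)
    rw [dist_comm] at hc'
    have hmul := hτ' _ (hcG ((g * s) p)) g hg (g * s) (G.mul_mem hg hs) hend
      (by rw [dist_comm, hgs]; linarith) (by linarith)
    rw [inv_mul_cancel_left] at hmul
    change b ((g * s) p) * τ ((c ((g * s) p))⁻¹ * (g * s)) = b (g p) * τ ((c (g p))⁻¹ * g) * τ s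
    rw [← hmul, ← mul_assoc, hseg]
  have hcob' : ∀ x, ∃ g ∈ G, dist (g p) x < C := fun x => ⟨c x, hcG x, hc x⟩
  -- `B 1` need not be trivial, so `B` is multiplicative only after division by it.
  have hmul : ∀ h ∈ G, ∀ g ∈ G, B (g * h) = B g * (B 1)⁻¹ * B h := by
    intro h hh
    refine chain_induction hX hC hcob' (r := dist (h p) p)
      (P := fun h => ∀ g ∈ G, B (g * h) = B g * (B 1)⁻¹ * B h) ?_ ?_ h hh le_rfl
    · intro h hh hhp g hg
      have := hstep 1 G.one_mem h hh hhp
      rw [one_mul] at this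
      rw [this, hstep g hg h hh hhp]
      group
    · intro u hu h hh _ hhp _ ih g hg
      rw [← mul_assoc, hstep _ (G.mul_mem hg hu) h hh hhp, ih g hg, hstep u hu h hh hhp, mul_assoc]
  refine ⟨MonoidHom.mk' (fun g => (B 1)⁻¹ * B g) fun g h => ?_, fun g hg => ?_⟩
  · change (B 1)⁻¹ * B (g * h) = _
    rw [hmul h h.2 g g.2]
    group
  · refine chain_induction hX hC hcob' (r := l) (P := fun g => (B 1)⁻¹ * B g = τ g) ?_ ?_ g g.2 hg
    · intro g hg hgp
      have := hstep 1 G.one_mem g hg hgp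
      rw [one_mul] at this
      rw [this, inv_mul_cancel_left]
    · intro u hu h hh hur hhp huh ih
      rw [hstep u hu h hh hhp, ← mul_assoc, ih, hτ u hu h hh hur (by linarith) huh]

/-! ### Fine approximations and classes of isometries -/

theorem IsGeodesicSpace.exists_dist_eq {X : Type*} [MetricSpace X] (hX : IsGeodesicSpace X)
    (x y : X) {t : ℝ} (ht : 0 ≤ t) (ht' : t ≤ dist x y) :
    ∃ z, dist z x = t ∧ dist z y = dist x y - t := by
  obtain ⟨γ, h0, h1, hγ⟩ := hX x y
  refine ⟨γ t, ?_, ?_⟩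
  · have := hγ t ⟨ht, ht'⟩ 0 ⟨le_rfl, ht.trans ht'⟩
    rwa [h0, sub_zero, abs_of_nonneg ht] at this
  · have := hγ t ⟨ht, ht'⟩ _ (right_mem_Icc.2 dist_nonneg)
    rwa [h1, abs_sub_comm, abs_of_nonneg (by linarith)] at this

theorem IsGeodesicSpace.exists_midpoint {X : Type*} [MetricSpace X] (hX : IsGeodesicSpace X)
    (x y : X) : ∃ z, dist z x = dist x y / 2 ∧ dist z y = dist x y / 2 := by
  have h0 : 0 ≤ dist x y := dist_nonneg
  obtain ⟨z, h1, h2⟩ := hX.exists_dist_eq x y (t := dist x y / 2) (by linarith) (by linarith)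
  exact ⟨z, h1, by linarith⟩

section ClassOf

variable {A Γ : Type*} [Group A] [Group Γ] {K : Subgroup A}

open Classical in
/-- The extension by `1` of a homomorphism defined on a subgroup. -/
def classOf (π : K →* Γ) (k : A) : Γ :=
  if h : k ∈ K then π ⟨k, h⟩ else 1

theorem classOf_of_mem (π : K →* Γ) {k : A} (hk : k ∈ K) : classOf π k = π ⟨k, hk⟩ :=
  dif_pos hk

theorem classOf_one (π : K →* Γ) : classOf π 1 = 1 := by
  rw [classOf_of_mem π K.one_mem]
  exact map_one π

theorem classOf_mul (π : K →* Γ) {k l : A} (hk : k ∈ K) (hl : l ∈ K) :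
    classOf π (k * l) = classOf π k * classOf π l := by
  rw [classOf_of_mem π hk, classOf_of_mem π hl, classOf_of_mem π (K.mul_mem hk hl), ← map_mul]
  rfl

theorem classOf_inv (π : K →* Γ) {k : A} (hk : k ∈ K) :
    classOf π k⁻¹ = (classOf π k)⁻¹ := by
  rw [classOf_of_mem π hk, classOf_of_mem π (K.inv_mem hk), ← map_inv]
  rfl

end ClassOf

/-- An equivariant approximation that is so fine that isometries in `K` which are close to each
other on some ball of radius `L` have the same image under `π`, and so large that products of
elements of displacement at most `l` can be compared. -/
structure IsFineApprox {X Y Γ : Type*} [MetricSpace X] [MetricSpace Y] [Group Γ] (ε : ℝ)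
    (p : X) (G : Subgroup (X ≃ᵢ X)) (q : Y) (K : Subgroup (Y ≃ᵢ Y))
    (f : X → Y) (φ : (X ≃ᵢ X) → (Y ≃ᵢ Y)) (ψ : (Y ≃ᵢ Y) → (X ≃ᵢ X))
    (π : K →* Γ) (L l : ℝ) : Prop where
  approx : IsEGHApprox ε p G q K f φ ψ
  geodesic : IsGeodesicSpace X
  L_pos : 0 < L
  separated : ∀ k₁ ∈ K, ∀ k₂ ∈ K, ∀ z, (∀ y ∈ ball z L, dist (k₁ y) (k₂ y) < 10 * ε) →
    classOf π k₁ = classOf π k₂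
  le_tenth : ε ≤ 1 / 10
  le_radius : 2 * (l + L + 1) ≤ 1 / ε

namespace IsFineApprox

variable {X Y Γ : Type*} [MetricSpace X] [MetricSpace Y] [Group Γ] {ε : ℝ}
  {p : X} {G : Subgroup (X ≃ᵢ X)} {q : Y} {K : Subgroup (Y ≃ᵢ Y)}
  {f : X → Y} {φ : (X ≃ᵢ X) → (Y ≃ᵢ Y)} {ψ : (Y ≃ᵢ Y) → (X ≃ᵢ X)}
  {π : K →* Γ} {L l : ℝ}

theorem ten_le_radius (h : IsFineApprox ε p G q K f φ ψ π L l) : 10 ≤ 1 / ε := by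
  rw [le_div_iff₀ h.approx.pos]
  linarith [h.le_tenth]

theorem base_mem (h : IsFineApprox ε p G q K f φ ψ π L l) : p ∈ ball p (1 / ε) :=
  mem_ball_self (by linarith [h.ten_le_radius])

theorem dist_map_base_le (h : IsFineApprox ε p G q K f φ ψ π L l) {x : X}
    (hx : x ∈ ball p (1 / ε)) : dist (f x) q ≤ dist x p + ε := by
  have := h.approx.distortion x hx p h.base_mem
  rw [h.approx.map_base] at this
  linarith [(abs_le.1 this).2]

theorem dist_base_le (h : IsFineApprox ε p G q K f φ ψ π L l) {x : X}
    (hx : x ∈ ball p (1 / ε)) : dist x p ≤ dist (f x) q + ε := by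
  have := h.approx.distortion x hx p h.base_mem
  rw [h.approx.map_base] at this
  linarith [(abs_le.1 this).1]

theorem dist_map_le (h : IsFineApprox ε p G q K f φ ψ π L l) {x y : X}
    (hx : x ∈ ball p (1 / ε)) (hy : y ∈ ball p (1 / ε)) : dist (f x) (f y) ≤ dist x y + ε := by
  linarith [(abs_le.1 (h.approx.distortion x hx y hy)).2]

theorem dist_le_map (h : IsFineApprox ε p G q K f φ ψ π L l) {x y : X}
    (hx : x ∈ ball p (1 / ε)) (hy : y ∈ ball p (1 / ε)) : dist x y ≤ dist (f x) (f y) + ε := by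
  linarith [(abs_le.1 (h.approx.distortion x hx y hy)).1]

theorem φ_mem (h : IsFineApprox ε p G q K f φ ψ π L l) {g : X ≃ᵢ X} (hg : g ∈ G)
    (hgp : dist (g p) p ≤ 1 / ε) : φ g ∈ K :=
  (h.approx.mapsTo_φ ⟨hg, hgp⟩).1

theorem ψ_mem (h : IsFineApprox ε p G q K f φ ψ π L l) {k : Y ≃ᵢ Y} (hk : k ∈ K)
    (hkq : dist (k q) q ≤ 1 / ε) : ψ k ∈ G :=
  (h.approx.mapsTo_ψ ⟨hk, hkq⟩).1

theorem dist_ψ_le_radius (h : IsFineApprox ε p G q K f φ ψ π L l) {k : Y ≃ᵢ Y} (hk : k ∈ K)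
    (hkq : dist (k q) q ≤ 1 / ε) : dist (ψ k p) p ≤ 1 / ε :=
  (h.approx.mapsTo_ψ ⟨hk, hkq⟩).2

/-- Isometries in the limit group that are close on the image of a ball have the same class. -/
theorem classOf_eq (h : IsFineApprox ε p G q K f φ ψ π L l) {k₁ k₂ : Y ≃ᵢ Y} (hk₁ : k₁ ∈ K)
    (hk₂ : k₂ ∈ K) {m : X} (hm : dist m p + L + 1 ≤ 1 / ε)
    (hclose : ∀ x ∈ ball m (L + 1), x ∈ ball p (1 / ε) →
      dist (k₁ (f x)) (k₂ (f x)) < 6 * ε) : classOf π k₁ = classOf π k₂ := by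
  have hL := h.L_pos
  have hε := h.approx.pos
  have hm' : m ∈ ball p (1 / ε) := by rw [mem_ball]; linarith
  refine h.separated k₁ hk₁ k₂ hk₂ (f m) fun y hy => ?_
  rw [mem_ball] at hy
  obtain ⟨x, hx, hxy⟩ := h.approx.dense y (by
    rw [mem_ball]
    linarith [dist_triangle y (f m) q, h.dist_map_base_le hm'])
  have hxm : dist x m < L + 1 := by
    have h1 := h.dist_le_map hx hm'
    have h2 := dist_triangle_left (f x) (f m) y
    linarith [h.le_tenth]
  have h1 := hclose x (mem_ball.2 hxm) hx
  -- Replacing `y` by `f x` costs `2 * ε` for each isometry, which explains `10 * ε` in `separated`.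
  have h2 := dist_triangle4 (k₁ y) (k₁ (f x)) (k₂ (f x)) (k₂ y)
  rw [k₁.dist_eq, k₂.dist_eq, dist_comm (f x)] at h2
  linarith

/-- The comparison is made around the midpoint `m` of `p` and `(g * g')⁻¹ p`. Both `m` and its image
under `g * g'` are at half the displacement from `p`, so a ball of fixed radius stays in the domain
of `f` even when the displacement is 1 / ε. Three uses of equivariance give an error below `3 * ε`.
-/
theorem classOf_φ_mul (h : IsFineApprox ε p G q K f φ ψ π L l) {g g' : X ≃ᵢ X} (hg : g ∈ G)
    (hg' : g' ∈ G) (hgp : dist (g p) p ≤ 1 / ε) (hg'p : dist (g' p) p ≤ l)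
    (hgg'p : dist ((g * g') p) p ≤ 1 / ε) :
    classOf π (φ (g * g')) = classOf π (φ g) * classOf π (φ g') := by
  have hL := h.L_pos
  have hr := h.le_radius
  have h10 := h.ten_le_radius
  have hl : 0 ≤ l := dist_nonneg.trans hg'p
  have hg'r : dist (g' p) p ≤ 1 / ε := by linarith
  have hgK := h.φ_mem hg hgp
  have hg'K := h.φ_mem hg' hg'r
  have hgg'K := h.φ_mem (G.mul_mem hg hg') hgg'p
  rw [← classOf_mul π hgK hg'K]
  obtain ⟨m, hm1, hm2⟩ := h.geodesic.exists_midpoint p ((g * g')⁻¹ p)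
  rw [dist_comm p, IsometryEquiv.dist_inv_apply, dist_comm p] at hm1 hm2
  rw [dist_comm, IsometryEquiv.dist_inv_apply, dist_comm] at hm2
  have hm3 : dist (g' m) p ≤ dist ((g * g') p) p / 2 + l := by
    have := dist_triangle (g' m) (g' p) p
    rw [g'.dist_eq] at this
    linarith
  refine h.classOf_eq hgg'K (K.mul_mem hgK hg'K) (m := m) (by linarith) fun x hx hxp => ?_
  rw [mem_ball] at hx
  have hx1 : g' x ∈ ball p (1 / ε) := by
    have := dist_triangle (g' x) (g' m) p
    rw [g'.dist_eq] at this
    rw [mem_ball]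
    linarith
  have hx2 : g (g' x) ∈ ball p (1 / ε) := by
    have := dist_triangle (g (g' x)) (g (g' m)) p
    rw [g.dist_eq, g'.dist_eq] at this
    rw [IsometryEquiv.mul_apply] at hm2
    rw [mem_ball]
    linarith
  have e1 := h.approx.equivariant_φ _ ⟨G.mul_mem hg hg', hgg'p⟩ x hxp hx2
  have e2 := h.approx.equivariant_φ _ ⟨hg', hg'r⟩ x hxp hx1
  have e3 := h.approx.equivariant_φ _ ⟨hg, hgp⟩ _ hx1 hx2
  rw [IsometryEquiv.mul_apply g g'] at e1
  have t1 := dist_triangle_right (φ (g * g') (f x)) (φ g (f (g' x))) (f (g (g' x)))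
  have t2 := dist_triangle_right (φ (g * g') (f x)) (φ g (φ g' (f x))) (φ g (f (g' x)))
  rw [(φ g).dist_eq] at t2
  rw [IsometryEquiv.mul_apply]
  linarith [h.approx.pos]

/-- The same midpoint argument shows that `φ (ψ k)` and `k` are within `2 * ε` on the image of a
ball. -/
theorem classOf_φ_ψ (h : IsFineApprox ε p G q K f φ ψ π L l) (hl : 0 ≤ l) {k : Y ≃ᵢ Y}
    (hk : k ∈ K) (hkq : dist (k q) q ≤ 1 / ε) : classOf π (φ (ψ k)) = classOf π k := by
  have hL := h.L_pos
  have hr := h.le_radius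
  have hψ := h.ψ_mem hk hkq
  have hψp := h.dist_ψ_le_radius hk hkq
  obtain ⟨m, hm1, hm2⟩ := h.geodesic.exists_midpoint p ((ψ k)⁻¹ p)
  rw [dist_comm p, IsometryEquiv.dist_inv_apply, dist_comm p] at hm1 hm2
  rw [dist_comm, IsometryEquiv.dist_inv_apply, dist_comm] at hm2
  refine h.classOf_eq (h.φ_mem hψ hψp) hk (m := m) (by linarith) fun x hx hxp => ?_
  rw [mem_ball] at hx
  have hx1 : ψ k x ∈ ball p (1 / ε) := by
    have := dist_triangle (ψ k x) (ψ k m) p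
    rw [(ψ k).dist_eq] at this
    rw [mem_ball]
    linarith
  have e1 := h.approx.equivariant_φ _ ⟨hψ, hψp⟩ x hxp hx1
  have e2 := h.approx.equivariant_ψ _ ⟨hk, hkq⟩ x hxp hx1
  have t1 := dist_triangle_right (φ (ψ k) (f x)) (k (f x)) (f (ψ k x))
  linarith [h.approx.pos]

theorem dist_φ_le (h : IsFineApprox ε p G q K f φ ψ π L l) {g : X ≃ᵢ X} (hg : g ∈ G)
    (hgp : dist (g p) p < 1 / ε) : dist (φ g q) q ≤ dist (g p) p + 1 / 2 := by
  have e := h.approx.equivariant_φ _ ⟨hg, hgp.le⟩ p h.base_mem (mem_ball.2 hgp)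
  rw [h.approx.map_base] at e
  linarith [dist_triangle (φ g q) (f (g p)) q, h.dist_map_base_le (mem_ball.2 hgp), h.le_tenth]

/-- Equivariance at `p` is not available if `ψ k p` lies on the boundary of the open ball. It is
used instead at a point `x` at distance `ε` from `p` towards `(ψ k)⁻¹ p`, which `ψ k` moves inside;
the detour and the distortions add up to `5 * ε`. -/
theorem dist_ψ_le (h : IsFineApprox ε p G q K f φ ψ π L l) {k : Y ≃ᵢ Y}
    (hk : k ∈ K) (hkq : dist (k q) q ≤ 1 / ε) : dist (ψ k p) p ≤ dist (k q) q + 5 * ε := by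
  have hε := h.approx.pos
  have h10 := h.ten_le_radius
  have ht := h.le_tenth
  have hψp := h.dist_ψ_le_radius hk hkq
  rcases le_or_gt (dist (ψ k p) p) ε with hle | hlt
  · linarith [dist_nonneg (x := k q) (y := q)]
  have hd : dist p ((ψ k)⁻¹ p) = dist (ψ k p) p := by
    rw [dist_comm p, IsometryEquiv.dist_inv_apply, dist_comm p]
  obtain ⟨x, hx1, hx2⟩ := h.geodesic.exists_dist_eq p ((ψ k)⁻¹ p) hε.le (by linarith)
  rw [hd, dist_comm x, IsometryEquiv.dist_inv_apply, dist_comm p] at hx2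
  have hx : x ∈ ball p (1 / ε) := by rw [mem_ball]; linarith
  have hψx : ψ k x ∈ ball p (1 / ε) := by rw [mem_ball]; linarith
  have e := h.approx.equivariant_ψ _ ⟨hk, hkq⟩ x hx hψx
  have t1 := dist_triangle4 (f (ψ k x)) (k (f x)) (k q) q
  rw [k.dist_eq, dist_comm (f (ψ k x)) (k (f x))] at t1
  linarith [h.dist_map_base_le hx, h.dist_base_le hψx]

theorem dist_ψ_le_add_half (h : IsFineApprox ε p G q K f φ ψ π L l) {k : Y ≃ᵢ Y}
    (hk : k ∈ K) (hkq : dist (k q) q ≤ 1 / ε) : dist (ψ k p) p ≤ dist (k q) q + 1 / 2 := by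
  linarith [h.dist_ψ_le hk hkq, h.le_tenth]

/-- Elements of `G` near the identity have trivial class. -/
theorem classOf_φ_eq_one (h : IsFineApprox ε p G q K f φ ψ π L l) (hl : 0 ≤ l) {g : X ≃ᵢ X}
    (hg : g ∈ G) (hclose : ∀ x ∈ ball p (L + 1), dist (g x) x < ε) : classOf π (φ g) = 1 := by
  have hL := h.L_pos
  have hr := h.le_radius
  have ht := h.le_tenth
  have h10 := h.ten_le_radius
  have hgp : dist (g p) p ≤ 1 / ε := by
    linarith [hclose p (mem_ball_self (by linarith))]
  rw [← classOf_one π]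
  refine h.classOf_eq (h.φ_mem hg hgp) K.one_mem (m := p) (by rw [dist_self]; linarith)
    fun x hx hxp => ?_
  have hgx := hclose x hx
  have hgxp : g x ∈ ball p (1 / ε) := by
    rw [mem_ball] at hx ⊢
    linarith [dist_triangle (g x) x p]
  have e := h.approx.equivariant_φ _ ⟨hg, hgp⟩ x hxp hgxp
  have := h.dist_map_le hgxp hxp
  change dist (φ g (f x)) (f x) < 6 * ε
  linarith [dist_triangle (φ g (f x)) (f (g x)) (f x), h.approx.pos]

/-- Products in the limit group are approximated by the products of lifts. -/
theorem list_prod_ψ (h : IsFineApprox ε p G q K f φ ψ π L l) {s : ℝ} (A : List (Y ≃ᵢ Y))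
    (hA : ∀ k ∈ A, k ∈ K ∧ dist (k q) q ≤ s) (hlen : (A.length + 1) * (s + 1) ≤ l) (hs : 0 ≤ s) :
    A.prod ∈ K ∧ (A.map ψ).prod ∈ G ∧ dist ((A.map ψ).prod p) p ≤ A.length * (s + 1) ∧
      dist (f ((A.map ψ).prod p)) (A.prod q) ≤ A.length * ε ∧
      classOf π (φ (A.map ψ).prod) = classOf π A.prod := by
  have hL := h.L_pos
  have hr := h.le_radius
  have hl : 0 ≤ l := le_trans (by positivity) hlen
  induction A with
  | nil =>
    refine ⟨K.one_mem, G.one_mem, ?_, ?_, ?_⟩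
    · simp
    · simp [h.approx.map_base]
    · simp only [List.map_nil, List.prod_nil]
      rw [classOf_one, h.classOf_φ_eq_one hl G.one_mem]
      intro x _
      simpa using h.approx.pos
  | cons a A ih =>
    rw [List.length_cons, Nat.cast_add, Nat.cast_one] at hlen
    have hAs : (0 : ℝ) ≤ A.length * (s + 1) := by positivity
    obtain ⟨hK, hG, hd, hf, hcl⟩ := ih (fun k hk => hA k (List.mem_cons_of_mem _ hk))
      (by linarith)
    obtain ⟨haK, haq⟩ := hA a List.mem_cons_self
    have har : dist (a q) q ≤ 1 / ε := by linarith
    have hψG := h.ψ_mem haK har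
    have hψr := h.dist_ψ_le_radius haK har
    have hψs := h.dist_ψ_le_add_half haK har
    rw [List.map_cons, List.prod_cons, List.prod_cons, List.length_cons, Nat.cast_add,
      Nat.cast_one]
    have hmul := IsometryEquiv.dist_mul_apply_le (ψ a) (A.map ψ).prod p
    refine ⟨K.mul_mem haK hK, G.mul_mem hψG hG, by linarith, ?_, ?_⟩
    · have e := h.approx.equivariant_ψ a ⟨haK, har⟩ ((A.map ψ).prod p)
        (by rw [mem_ball]; linarith)
        (by rw [mem_ball, ← IsometryEquiv.mul_apply]; linarith)
      rw [IsometryEquiv.mul_apply, IsometryEquiv.mul_apply]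
      have t := dist_triangle_left (f (ψ a ((A.map ψ).prod p))) (a (A.prod q))
        (a (f ((A.map ψ).prod p)))
      rw [a.dist_eq] at t
      linarith
    · rw [h.classOf_φ_mul hψG hG hψr (by linarith) (by linarith), hcl, h.classOf_φ_ψ hl haK har,
        classOf_mul π haK hK]

end IsFineApprox

/-! ### Separation of classes, finiteness and coboundedness -/

theorem IsometryEquiv.nhds_hasBasis {X : Type*} [MetricSpace X] (g : X ≃ᵢ X) :
    (𝓝 g).HasBasis (fun i : Set X × ℝ => IsCompact i.1 ∧ 0 < i.2)
      fun i => {h | ∀ x ∈ i.1, dist (h x) (g x) < i.2} := by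
  rw [nhds_induced]
  have := (nhds_basis_uniformity
    (uniformity_basis_dist (α := X)).compactConvergenceUniformity
    (x := (⟨g, g.continuous⟩ : C(X, X)))).comap
    (fun g : X ≃ᵢ X => (⟨g, g.continuous⟩ : C(X, X)))
  exact this

/-- If `K'` is an open normal subgroup of a cobounded group `K`, then isometries in `K` that are
close on some ball of a fixed radius agree modulo `K'`. -/
theorem exists_separated {Y : Type*} [MetricSpace Y] {q : Y} {K K' : Subgroup (Y ≃ᵢ Y)}
    [(K'.subgroupOf K).Normal] (hopen : IsOpen (K'.subgroupOf K : Set K)) {C : ℝ}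
    (hcob : ∀ y, ∃ k ∈ K, dist (k q) y < C) :
    ∃ L > 0, ∃ η > 0, ∀ k₁ ∈ K, ∀ k₂ ∈ K, ∀ z : Y,
      (∀ y ∈ ball z L, dist (k₁ y) (k₂ y) < η) → k₁⁻¹ * k₂ ∈ K' := by
  obtain ⟨U, hU, hUK⟩ := isOpen_induced_iff.1 hopen
  have h1 : (1 : Y ≃ᵢ Y) ∈ U := by
    have : (1 : K) ∈ Subtype.val ⁻¹' U := by
      rw [hUK]
      exact (K'.subgroupOf K).one_mem
    exact this
  obtain ⟨⟨B, η⟩, ⟨hB, hη⟩, hBU⟩ := (IsometryEquiv.nhds_hasBasis 1).mem_iff.1 (hU.mem_nhds h1)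
  obtain ⟨L₀, hL₀⟩ := hB.isBounded.subset_ball q
  have hC : 0 < C := by
    obtain ⟨k, -, hk⟩ := hcob q
    exact dist_nonneg.trans_lt hk
  refine ⟨max L₀ 0 + C, by positivity, η, hη, fun k₁ hk₁ k₂ hk₂ z hz => ?_⟩
  obtain ⟨u, hu, huz⟩ := hcob z
  -- Conjugation by `u`, which moves `q` to within `C` of `z`, brings the comparison back to a fixed
  -- neighbourhood of the identity; normality undoes the conjugation.
  have hmem : (⟨u, hu⟩⁻¹ * (⟨k₁, hk₁⟩⁻¹ * ⟨k₂, hk₂⟩) * ⟨u, hu⟩ : K) ∈ K'.subgroupOf K := by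
    rw [← SetLike.mem_coe, ← hUK]
    refine hBU fun y hy => ?_
    change dist ((u⁻¹ * (k₁⁻¹ * k₂) * u) y) y < η
    rw [mul_assoc, IsometryEquiv.dist_inv_mul_apply, mul_assoc, IsometryEquiv.dist_inv_mul_apply,
      dist_comm]
    refine hz _ ?_
    have := dist_triangle (u y) (u q) z
    rw [u.dist_eq] at this
    rw [mem_ball]
    have hyq := mem_ball.1 (hL₀ hy)
    linarith [le_max_left L₀ 0]
  have := (inferInstance : (K'.subgroupOf K).Normal).conj_mem _ hmem ⟨u, hu⟩
  rw [show (⟨u, hu⟩ * (⟨u, hu⟩⁻¹ * (⟨k₁, hk₁⟩⁻¹ * ⟨k₂, hk₂⟩) * ⟨u, hu⟩) * ⟨u, hu⟩⁻¹ : K) =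
    ⟨k₁, hk₁⟩⁻¹ * ⟨k₂, hk₂⟩ by group] at this
  exact this

theorem Set.Finite.image_of_code {α β T : Type*} [Finite T] {A : Set α} {F : α → β} (c : α → T)
    (hc : ∀ a ∈ A, ∀ b ∈ A, c a = c b → F a = F b) : (F '' A).Finite := by
  classical
  rcases A.eq_empty_or_nonempty with rfl | ⟨a₀, -⟩
  · simp
  refine (Set.finite_range fun t : T =>
    if h : ∃ a ∈ A, c a = t then F h.choose else F a₀).subset ?_
  rintro _ ⟨a, ha, rfl⟩
  have h : ∃ b ∈ A, c b = c a := ⟨a, ha, rfl⟩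
  refine ⟨c a, ?_⟩
  simp only [dif_pos h]
  exact hc _ h.choose_spec.1 _ ha h.choose_spec.2

/-- A map that identifies isometries which are close on a ball takes finitely many values on the
isometries of bounded displacement. -/
theorem finite_image_of_separated {Y β : Type*} [MetricSpace Y] [ProperSpace Y] {q : Y}
    {A : Set (Y ≃ᵢ Y)} {M L η : ℝ} (hη : 0 < η) (hA : ∀ k ∈ A, dist (k q) q ≤ M)
    {F : (Y ≃ᵢ Y) → β}
    (hF : ∀ k₁ ∈ A, ∀ k₂ ∈ A, (∀ y ∈ ball q L, dist (k₁ y) (k₂ y) < η) → F k₁ = F k₂) :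
    (F '' A).Finite := by
  classical
  obtain ⟨N₁, hN₁, hN₁f, hcov₁⟩ := finite_approx_of_totallyBounded
    (isCompact_closedBall q L).totallyBounded (η / 4) (by positivity)
  obtain ⟨N₂, -, hN₂f, hcov₂⟩ := finite_approx_of_totallyBounded
    (isCompact_closedBall q (L + M)).totallyBounded (η / 4) (by positivity)
  -- The code of `k` records, for each net point of the source, a net point near its image; `none`
  -- is a default value outside `A`.
  have hex : ∀ (k : Y ≃ᵢ Y) (n : N₁), ∃ m : Option N₂, k ∈ A → ∃ m' : N₂, m = some m' ∧
      dist (k n) m' < η / 4 := by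
    intro k n
    by_cases hk : k ∈ A
    · have : k n ∈ closedBall q (L + M) := by
        have h1 := dist_triangle (k n) (k q) q
        have h2 := mem_closedBall.1 (hN₁ n.2)
        rw [k.dist_eq] at h1
        rw [mem_closedBall]
        linarith [hA k hk]
      obtain ⟨m, hm, hkm⟩ := mem_iUnion₂.1 (hcov₂ this)
      exact ⟨some ⟨m, hm⟩, fun _ => ⟨_, rfl, hkm⟩⟩
    · exact ⟨none, fun h => absurd h hk⟩
  choose c hc using hex
  have := hN₁f.to_subtype
  have := hN₂f.to_subtype
  refine Set.Finite.image_of_code c fun k₁ hk₁ k₂ hk₂ h => hF k₁ hk₁ k₂ hk₂ fun y hy => ?_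
  obtain ⟨n, hn, hyn⟩ := mem_iUnion₂.1 (hcov₁ (ball_subset_closedBall hy))
  obtain ⟨m₁, hm₁, hd₁⟩ := hc k₁ ⟨n, hn⟩ hk₁
  obtain ⟨m₂, hm₂, hd₂⟩ := hc k₂ ⟨n, hn⟩ hk₂
  rw [← h, hm₁, Option.some_inj] at hm₂
  rw [← hm₂] at hd₂
  have t1 := dist_triangle4 (k₁ y) (k₁ n) (k₂ n) (k₂ y)
  have t2 := dist_triangle_right (k₁ n) (k₂ n) m₁
  rw [k₁.dist_eq, k₂.dist_eq, dist_comm n y] at t1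
  rw [mem_ball] at hyn
  linarith

/-- Finitely many representatives suffice up to `η` at `q`, so conditions depending on the length of
a word for each of them can hold simultaneously. -/
theorem exists_finite_orbit_approx {Y : Type*} [MetricSpace Y] [ProperSpace Y] {q : Y}
    {A : Set (Y ≃ᵢ Y)} {M η : ℝ} (hη : 0 < η) (hA : ∀ k ∈ A, dist (k q) q ≤ M) :
    ∃ F ⊆ A, F.Finite ∧ ∀ k ∈ A, ∃ k' ∈ F, dist (k q) (k' q) < η := by
  have htb : TotallyBounded ((fun k : Y ≃ᵢ Y => k q) '' A) :=
    (isCompact_closedBall q M).totallyBounded.subset (by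
      rintro _ ⟨k, hk, rfl⟩
      exact hA k hk)
  obtain ⟨F, hFA, hF, hcov⟩ :=
    Set.exists_subset_image_finite_and.1 (finite_approx_of_totallyBounded htb η hη)
  refine ⟨F, hFA, hF, fun k hk => ?_⟩
  obtain ⟨_, ⟨k', hk', rfl⟩, h⟩ := mem_iUnion₂.1 (hcov ⟨k, hk, rfl⟩)
  exact ⟨k', hk', h⟩

theorem exists_dist_lt_of_orbitSpaceDiam_lt {X : Type*} [MetricSpace X] {G : Subgroup (X ≃ᵢ X)}
    {D : ℝ} (hD : orbitSpaceDiam G < ENNReal.ofReal D) (p x : X) : ∃ g ∈ G, dist (g p) x < D := by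
  have h : ⨅ g : G, edist x ((g : X ≃ᵢ X) p) < ENNReal.ofReal D :=
    (le_iSup₂ (f := fun x y => ⨅ g : G, edist x ((g : X ≃ᵢ X) y)) x p).trans_lt hD
  obtain ⟨g, hg⟩ := iInf_lt_iff.1 h
  refine ⟨g, g.2, ?_⟩
  rw [edist_dist, ENNReal.ofReal_lt_ofReal_iff_of_nonneg dist_nonneg] at hg
  rwa [dist_comm]

/-- Inverses of letters are again letters, so words without formal inverses suffice. -/
theorem Subgroup.exists_list_map_prod_eq {ι A : Type*} [Group A] {F : ι → A} {s : Set ι}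
    (hinv : ∀ i ∈ s, ∃ j ∈ s, F j = (F i)⁻¹) {x : A} (hx : x ∈ Subgroup.closure (F '' s)) :
    ∃ B : List ι, (∀ i ∈ B, i ∈ s) ∧ (B.map F).prod = x := by
  have hinv' : ∀ B : List ι, (∀ i ∈ B, i ∈ s) →
      ∃ B' : List ι, (∀ i ∈ B', i ∈ s) ∧ (B'.map F).prod = (B.map F).prod⁻¹ := by
    intro B
    induction B with
    | nil => exact fun _ => ⟨[], by simp, by simp⟩
    | cons i B ih =>
      intro hB
      obtain ⟨B', hB', hprod⟩ := ih fun i hi => hB i (List.mem_cons_of_mem _ hi)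
      obtain ⟨j, hj, hji⟩ := hinv i (hB i List.mem_cons_self)
      refine ⟨B' ++ [j], fun k hk => ?_, by simp [hprod, hji]⟩
      rcases List.mem_append.1 hk with hk | hk
      · exact hB' k hk
      · rwa [List.mem_singleton.1 hk]
  induction hx using Subgroup.closure_induction with
  | mem _ h =>
    obtain ⟨i, hi, rfl⟩ := h
    exact ⟨[i], by simpa using hi, by simp⟩
  | one => exact ⟨[], by simp, rfl⟩
  | mul _ _ _ _ ihg ihh =>
    obtain ⟨A, hA, rfl⟩ := ihg
    obtain ⟨B, hB, rfl⟩ := ihh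
    refine ⟨A ++ B, fun k hk => (List.mem_append.1 hk).elim (hA k) (hB k), ?_⟩
    rw [List.map_append, List.prod_append]
  | inv _ _ ih =>
    obtain ⟨B, hB, rfl⟩ := ih
    exact hinv' B hB

theorem inv_mem_displacementBall {X : Type*} [MetricSpace X] {H : Subgroup (X ≃ᵢ X)} {p : X}
    {r : ℝ} {g : X ≃ᵢ X} (hg : g ∈ displacementBall H p r) : g⁻¹ ∈ displacementBall H p r := by
  refine ⟨H.inv_mem hg.1, ?_⟩
  rw [IsometryEquiv.dist_inv_apply, dist_comm]
  exact hg.2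

theorem exists_list_of_mem_closure_displacementBall {X : Type*} [MetricSpace X]
    {H : Subgroup (X ≃ᵢ X)} {p : X} {r : ℝ} {g : X ≃ᵢ X}
    (hg : g ∈ Subgroup.closure (displacementBall H p r)) :
    ∃ A : List (X ≃ᵢ X), (∀ k ∈ A, k ∈ displacementBall H p r) ∧ A.prod = g := by
  rw [← Set.image_id (displacementBall H p r)] at hg
  obtain ⟨B, hB, hBg⟩ := Subgroup.exists_list_map_prod_eq (F := id)
    (fun i hi => ⟨i⁻¹, inv_mem_displacementBall hi, rfl⟩) hg
  exact ⟨B, hB, by rwa [List.map_id] at hBg⟩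

/-- The limit of uniformly cobounded groups is cobounded. -/
theorem EGHConvergesVia.cobounded {X : ℕ → Type*} [∀ i, MetricSpace (X i)] {Y : Type*}
    [MetricSpace Y] {p : ∀ i, X i} {G : ∀ i, Subgroup (X i ≃ᵢ X i)} {q : Y}
    {K : Subgroup (Y ≃ᵢ Y)} {f : ∀ i, X i → Y} (hf : EGHConvergesVia p G q K f) {D : ℝ}
    (hD : ∀ i x, ∃ g ∈ G i, dist (g (p i)) x < D) (y : Y) :
    ∃ k ∈ K, dist (k q) y < D + 1 := by
  obtain ⟨ε, hε, hev⟩ := hf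
  have hD0 : 0 < D := by
    obtain ⟨g, -, hg⟩ := hD 0 (p 0)
    exact dist_nonneg.trans_lt hg
  have hy : 0 ≤ dist y q := dist_nonneg
  have hsmall : ∀ᶠ i in atTop, ε i < 1 / (dist y q + D + 10) :=
    hε.eventually_lt_const (by positivity)
  obtain ⟨i, ⟨φ, ψ, h⟩, hi⟩ := (hev.and hsmall).exists
  have hr : dist y q + D + 10 < 1 / ε i := (lt_one_div h.pos (by positivity)).1 hi
  have hε10 : ε i < 1 / 10 := hi.trans_le (one_div_le_one_div_of_le (by norm_num) (by linarith))
  have hpos := h.pos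
  have hp : p i ∈ ball (p i) (1 / ε i) := mem_ball_self (by linarith)
  obtain ⟨x, hx, hxy⟩ := h.dense y (by rw [mem_ball]; linarith)
  have d1 := (abs_le.1 (h.distortion x hx _ hp)).1
  rw [h.map_base] at d1
  have hxp : dist x (p i) ≤ dist y q + 3 * ε i := by
    linarith [dist_triangle_left (f i x) q y]
  obtain ⟨g, hg, hgx⟩ := hD i x
  have hgp : dist (g (p i)) (p i) < 1 / ε i := by
    linarith [dist_triangle (g (p i)) x (p i)]
  have e := h.equivariant_φ g ⟨hg, hgp.le⟩ _ hp (mem_ball.2 hgp)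
  rw [h.map_base] at e
  have d2 := (abs_le.1 (h.distortion _ (mem_ball.2 hgp) x hx)).2
  refine ⟨φ g, (h.mapsTo_φ ⟨hg, hgp.le⟩).1, ?_⟩
  -- The errors are `ε` for equivariance, `ε` for distortion and `2 * ε` for density, in total less
  -- than 1.
  have t := dist_triangle4 (φ g q) (f i (g (p i))) (f i x) y
  rw [dist_comm (f i x) y] at t
  linarith

theorem classOf_list_prod {A Γ : Type*} [Group A] [Group Γ] {K : Subgroup A} (π : K →* Γ)
    {B : List A} (hB : ∀ k ∈ B, k ∈ K) : classOf π B.prod = (B.map (classOf π)).prod := by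
  induction B with
  | nil => exact classOf_one π
  | cons k B ih =>
    have hB' : ∀ k ∈ B, k ∈ K := fun k hk => hB k (List.mem_cons_of_mem _ hk)
    rw [List.prod_cons, classOf_mul π (hB k List.mem_cons_self) (K.list_prod_mem hB'), ih hB',
      List.map_cons, List.prod_cons]

/-! ### Relations in the limit and the presentation of the quotient -/

/-- A map that is multiplicative on the classes of small displacement pulls back to a homomorphism
on a group that is finely approximated. -/
theorem IsFineApprox.exists_monoidHom {X Y Γ H : Type*} [MetricSpace X] [SimplyConnectedSpace X]
    [MetricSpace Y] [Group Γ] [Group H] {ε : ℝ} {p : X} {G : Subgroup (X ≃ᵢ X)} {q : Y}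
    {K : Subgroup (Y ≃ᵢ Y)} {f : X → Y} {φ : (X ≃ᵢ X) → (Y ≃ᵢ Y)} {ψ : (Y ≃ᵢ Y) → (X ≃ᵢ X)}
    {π : K →* Γ} {L l' : ℝ} (h : IsFineApprox ε p G q K f φ ψ π L l') {C : ℝ} (hC : 0 < C)
    (hcob : ∀ x, ∃ g ∈ G, dist (g p) x < C) {l : ℝ} (hl : 3 * C + 2 ≤ l) (hll' : l ≤ l')
    {θ : Γ → H}
    (hθ : ∀ a ∈ classOf π '' displacementBall K q (l + 1),
      ∀ b ∈ classOf π '' displacementBall K q (l + 1),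
      a * b ∈ classOf π '' displacementBall K q (l + 1) → θ (a * b) = θ a * θ b) :
    ∃ ρ : G →* H, ∀ g ∈ G, dist (g p) p ≤ l → classOf ρ g = θ (classOf π (φ g)) := by
  have hr := h.le_radius
  have hL := h.L_pos
  -- Passing to `φ g` raises the displacement by at most 1/2, hence the radius `l + 1`.
  have hmem : ∀ g ∈ G, dist (g p) p ≤ l →
      classOf π (φ g) ∈ classOf π '' displacementBall K q (l + 1) := by
    intro g hg hgp
    refine ⟨φ g, ⟨h.φ_mem hg (by linarith), ?_⟩, rfl⟩
    linarith [h.dist_φ_le hg (by linarith)]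
  obtain ⟨ρ, hρ⟩ := exists_monoidHom_extending h.geodesic hC hcob hl
    (fun g => θ (classOf π (φ g))) fun g hg g' hg' hgp hg'p hgg'p => by
      have hmul := h.classOf_φ_mul hg hg' (by linarith) (by linarith) (by linarith)
      have h3 := hmem _ (G.mul_mem hg hg') hgg'p
      rw [hmul] at h3
      simp only [hmul]
      exact hθ _ (hmem g hg hgp) _ (hmem g' hg' hg'p) h3
  refine ⟨ρ, fun g hg hgp => ?_⟩
  rw [classOf_of_mem ρ hg]
  exact hρ ⟨g, hg⟩ hgp

/-- Relations between elements of small displacement in the limit group hold in every group into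
which the classes map multiplicatively. -/
theorem map_classOf_prod_eq_of_prod_eq {X : ℕ → Type*} [∀ i, MetricSpace (X i)]
    [∀ i, SimplyConnectedSpace (X i)] {Y Γ H : Type*} [MetricSpace Y] [Group Γ] [Group H]
    {ε : ℕ → ℝ} {p : ∀ i, X i} {G : ∀ i, Subgroup (X i ≃ᵢ X i)} {q : Y} {K : Subgroup (Y ≃ᵢ Y)}
    {f : ∀ i, X i → Y} {φ : ∀ i, (X i ≃ᵢ X i) → (Y ≃ᵢ Y)} {ψ : ∀ i, (Y ≃ᵢ Y) → (X i ≃ᵢ X i)}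
    {π : K →* Γ} {L : ℝ}
    (hfine : ∀ l, ∀ᶠ i in atTop,
      IsFineApprox (ε i) (p i) (G i) q K (f i) (φ i) (ψ i) π L l)
    {C : ℝ} (hC : 0 < C) (hcob : ∀ i x, ∃ g ∈ G i, dist (g (p i)) x < C) {l : ℝ}
    (hl : 3 * C + 2 ≤ l) {θ : Γ → H}
    (hθ : ∀ a ∈ classOf π '' displacementBall K q (l + 1),
      ∀ b ∈ classOf π '' displacementBall K q (l + 1),
      a * b ∈ classOf π '' displacementBall K q (l + 1) → θ (a * b) = θ a * θ b)
    {A B : List (Y ≃ᵢ Y)} (hA : ∀ k ∈ A, k ∈ displacementBall K q (l - 1))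
    (hB : ∀ k ∈ B, k ∈ displacementBall K q (l - 1)) (hAB : A.prod = B.prod) :
    (A.map fun k => θ (classOf π k)).prod = (B.map fun k => θ (classOf π k)).prod := by
  obtain ⟨i, h⟩ := (hfine ((A.length + B.length + 1) * l)).exists
  have hr := h.le_radius
  have hL := h.L_pos
  have hε := h.approx.pos
  have hAl : (0 : ℝ) ≤ A.length * l := mul_nonneg (Nat.cast_nonneg _) (by linarith)
  have hBl : (0 : ℝ) ≤ B.length * l := mul_nonneg (Nat.cast_nonneg _) (by linarith)
  have hlong : ((A.length : ℝ) + B.length + 1) * ε i ≤ 1 := by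
    rw [le_div_iff₀ hε] at hr
    have h1 : ((A.length : ℝ) + B.length + 1) * 1 ≤
        2 * ((A.length + B.length + 1) * l + L + 1) := by
      have : ((A.length : ℝ) + B.length + 1) * 1 ≤ (A.length + B.length + 1) * l :=
        mul_le_mul_of_nonneg_left (by linarith) (by positivity)
      linarith
    have := mul_le_mul_of_nonneg_right h1 hε.le
    rw [mul_one] at this
    exact this.trans hr
  obtain ⟨ρ, hρ⟩ := h.exists_monoidHom hC (hcob i) hl
    (by linarith : l ≤ (A.length + B.length + 1) * l) hθ
  obtain ⟨hAK, hAG, hAd, hAf, hAc⟩ := h.list_prod_ψ A hA (by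
    rw [sub_add_cancel]; linarith) (by linarith)
  obtain ⟨hBK, hBG, hBd, hBf, hBc⟩ := h.list_prod_ψ B hB (by
    rw [sub_add_cancel]; linarith) (by linarith)
  rw [sub_add_cancel] at hAd hBd
  have hlift : ∀ D : List (Y ≃ᵢ Y), (∀ k ∈ D, k ∈ displacementBall K q (l - 1)) →
      classOf ρ (D.map (ψ i)).prod = (D.map fun k => θ (classOf π k)).prod := by
    intro D hD
    have hkr : ∀ k ∈ D, dist (k q) q ≤ 1 / ε i := fun k hk => by linarith [(hD k hk).2]
    rw [classOf_list_prod ρ, List.map_map]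
    · refine congrArg List.prod (List.map_congr_left fun k hk => ?_)
      have hψ := h.dist_ψ_le_add_half (hD k hk).1 (hkr k hk)
      rw [Function.comp_apply, hρ _ (h.ψ_mem (hD k hk).1 (hkr k hk)) (by linarith [(hD k hk).2]),
        h.classOf_φ_ψ (by linarith) (hD k hk).1 (hkr k hk)]
    · intro g hg
      obtain ⟨k, hk, rfl⟩ := List.mem_map.1 hg
      exact h.ψ_mem (hD k hk).1 (hkr k hk)
  rw [← hlift A hA, ← hlift B hB]
  set a := (A.map (ψ i)).prod
  set b := (B.map (ψ i)).prod
  -- The lifts may leave the region where `ρ` is given by `θ`, so they are compared through `a⁻¹ *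
  -- b`. Each letter contributes an error `ε i` and the distortion one more, which `hlong` bounds by
  -- 1.
  have hd : dist ((a⁻¹ * b) (p i)) (p i) ≤ 1 := by
    rw [IsometryEquiv.dist_inv_mul_apply]
    have h1 := h.dist_le_map (x := b (p i)) (y := a (p i)) (by rw [mem_ball]; linarith)
      (by rw [mem_ball]; linarith)
    rw [hAB] at hAf
    linarith [dist_triangle_right (f i (b (p i))) (f i (a (p i))) (B.prod q)]
  have hab : a⁻¹ * b ∈ G i := (G i).mul_mem ((G i).inv_mem hAG) hBG
  -- Both lifts have the class of the common product, so `a⁻¹ * b` has trivial class and `ρ` sends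
  -- it to `θ 1 = 1`.
  have hmul := h.classOf_φ_mul hAG hab (by linarith) (by linarith)
    (by rw [mul_inv_cancel_left]; linarith)
  rw [mul_inv_cancel_left, hAc, hBc, hAB, left_eq_mul] at hmul
  have hone : (1 : Γ) ∈ classOf π '' displacementBall K q (l + 1) :=
    ⟨1, ⟨K.one_mem, by simp; linarith⟩, classOf_one π⟩
  have hθ1 : θ 1 = 1 := by
    have := hθ 1 hone 1 hone (by rwa [mul_one])
    rwa [mul_one, left_eq_mul] at this
  have hρab := hρ _ hab (by linarith)
  rw [hmul, hθ1] at hρab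
  rw [← mul_inv_cancel_left a b, classOf_mul ρ hAG hab, hρab, mul_one]

/-- The relators of the multiplication table of a subset of a group. -/
def tableRelators {Γ : Type*} [Group Γ] (T : Set Γ) : Set (FreeGroup T) :=
  {w | ∃ a b c : T, (a : Γ) * b = c ∧ w = FreeGroup.of a * FreeGroup.of b * (FreeGroup.of c)⁻¹}

theorem finite_tableRelators {Γ : Type*} [Group Γ] {T : Set Γ} (hT : T.Finite) :
    (tableRelators T).Finite := by
  have := hT.to_subtype
  refine (Set.finite_range fun t : T × T × T =>
    FreeGroup.of t.1 * FreeGroup.of t.2.1 * (FreeGroup.of t.2.2)⁻¹).subset ?_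
  rintro _ ⟨a, b, c, -, rfl⟩
  exact ⟨(a, b, c), rfl⟩

/-- A map on `T` that is multiplicative wherever the product stays in `T` extends to the group
presented by the multiplication table of `T`. -/
theorem exists_tablePresented_hom {Γ H : Type*} [Group Γ] [Group H] {T : Set Γ} (θ : Γ → H)
    (hθ : ∀ a ∈ T, ∀ b ∈ T, a * b ∈ T → θ (a * b) = θ a * θ b) :
    ∃ Φ : PresentedGroup (tableRelators T) →* H,
      ∀ t : T, Φ (PresentedGroup.of t) = θ t := by
  have hrel : ∀ w ∈ tableRelators T, FreeGroup.lift (fun t : T => θ t) w = 1 := by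
    rintro _ ⟨a, b, c, habc, rfl⟩
    have hc := c.2
    rw [← habc] at hc
    simp [← habc, hθ a a.2 b b.2 hc]
  exact ⟨PresentedGroup.toGroup hrel, fun t => PresentedGroup.toGroup.of hrel⟩

open Classical in
/-- The canonical map from `T` to the group presented by its multiplication table, extended
by `1`. -/
def tableGen {Γ : Type*} [Group Γ] (T : Set Γ) (t : Γ) : PresentedGroup (tableRelators T) :=
  if h : t ∈ T then PresentedGroup.of ⟨t, h⟩ else 1

theorem tableGen_mul {Γ : Type*} [Group Γ] {T : Set Γ} (a : Γ) (ha : a ∈ T) (b : Γ) (hb : b ∈ T)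
    (hab : a * b ∈ T) : tableGen T (a * b) = tableGen T a * tableGen T b := by
  rw [tableGen, tableGen, tableGen, dif_pos ha, dif_pos hb, dif_pos hab]
  have : PresentedGroup.mk (tableRelators T) (FreeGroup.of ⟨a, ha⟩ * FreeGroup.of ⟨b, hb⟩ *
      (FreeGroup.of ⟨a * b, hab⟩)⁻¹) = 1 :=
    PresentedGroup.one_of_mem ⟨⟨a, ha⟩, ⟨b, hb⟩, ⟨a * b, hab⟩, rfl, rfl⟩
  rw [map_mul, map_mul, map_inv, mul_inv_eq_one] at this
  exact this.symm

/-- The quotient of the limit group is presented by the multiplication table of the classes of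
bounded displacement. -/
theorem exists_tablePresented_mulEquiv {X : ℕ → Type*} [∀ i, MetricSpace (X i)]
    [∀ i, SimplyConnectedSpace (X i)] {Y Γ : Type*} [MetricSpace Y] [Group Γ]
    (hY : IsGeodesicSpace Y)
    {ε : ℕ → ℝ} {p : ∀ i, X i} {G : ∀ i, Subgroup (X i ≃ᵢ X i)} {q : Y}
    {K K' : Subgroup (Y ≃ᵢ Y)}
    {f : ∀ i, X i → Y} {φ : ∀ i, (X i ≃ᵢ X i) → (Y ≃ᵢ Y)} {ψ : ∀ i, (Y ≃ᵢ Y) → (X i ≃ᵢ X i)}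
    {π : K →* Γ} {L : ℝ}
    (hfine : ∀ l, ∀ᶠ i in atTop,
      IsFineApprox (ε i) (p i) (G i) q K (f i) (φ i) (ψ i) π L l)
    {C : ℝ} (hC : 0 < C) (hcob : ∀ i x, ∃ g ∈ G i, dist (g (p i)) x < C)
    (hcobY : ∀ y, ∃ k ∈ K, dist (k q) y < C) {l R : ℝ}
    (hl : 3 * C + 2 ≤ l) (hRl : R ≤ l - 1) (hπ : Function.Surjective π) (hK'K : K' ≤ K)
    (hker : ∀ k ∈ K, classOf π k = 1 ↔ k ∈ K')
    (hgen : Subgroup.closure (displacementBall K' q R) = K') :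
    ∃ Φ : PresentedGroup (tableRelators (classOf π '' displacementBall K q (l + 1))) ≃* Γ,
      ∀ t, Φ (PresentedGroup.of t) = t := by
  set T := classOf π '' displacementBall K q (l + 1) with hT
  obtain ⟨Φ, hΦ⟩ := exists_tablePresented_hom (T := T) (fun t : Γ => t) fun _ _ _ _ _ => rfl
  have hTmem : ∀ k ∈ K, dist (k q) q ≤ l + 1 → classOf π k ∈ T := fun k hk hkq =>
    ⟨k, ⟨hk, hkq⟩, rfl⟩
  have hΦgen : ∀ t ∈ T, Φ (tableGen T t) = t := fun t ht => by
    rw [tableGen, dif_pos ht, hΦ]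
  have hsmall : ∀ k ∈ displacementBall K q (2 * C + 1), classOf π k ∈ T := fun k hk =>
    hTmem k hk.1 (by linarith [hk.2])
  have honeT : (1 : Γ) ∈ T := by
    rw [← classOf_one π]
    exact hTmem 1 K.one_mem (by simp; linarith)
  have hgen1 : tableGen T (1 : Γ) = 1 := by
    have := tableGen_mul (T := T) 1 honeT 1 honeT (by rwa [mul_one])
    rwa [mul_one, left_eq_mul] at this
  -- The relation lemma only admits letters of displacement at most `l - 1`. Chains inside the table
  -- express all generators through letters of displacement at most `2 * C + 1`.
  have htop : Subgroup.closure ((fun k => tableGen T (classOf π k)) ''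
      displacementBall K q (2 * C + 1)) = ⊤ := by
    rw [eq_top_iff, ← PresentedGroup.closure_range_of, Subgroup.closure_le]
    rintro _ ⟨⟨t, ht⟩, rfl⟩
    obtain ⟨k, ⟨hk, hkq⟩, rfl⟩ := id ht
    have : PresentedGroup.of ⟨classOf π k, ht⟩ = tableGen T (classOf π k) := by
      rw [tableGen, dif_pos ht]
    rw [this]
    refine chain_induction hY hC hcobY (r := l + 1)
      (P := fun k => tableGen T (classOf π k) ∈ Subgroup.closure
        ((fun k => tableGen T (classOf π k)) '' displacementBall K q (2 * C + 1))) ?_ ?_ k hk hkq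
    · exact fun k hk hkq => Subgroup.subset_closure ⟨k, ⟨hk, hkq⟩, rfl⟩
    · intro u hu v hv hur hvr huv ih
      have huvT := hTmem _ (K.mul_mem hu hv) huv
      rw [classOf_mul π hu hv] at huvT ⊢
      rw [tableGen_mul _ (hTmem u hu hur) _ (hsmall v ⟨hv, hvr⟩) huvT]
      exact Subgroup.mul_mem _ ih (Subgroup.subset_closure ⟨v, ⟨hv, hvr⟩, rfl⟩)
  have hinj : Function.Injective Φ := by
    rw [injective_iff_map_eq_one]
    intro x hx
    have hx' : x ∈ Subgroup.closure ((fun k => tableGen T (classOf π k)) ''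
        displacementBall K q (2 * C + 1)) := htop ▸ Subgroup.mem_top x
    obtain ⟨A, hA, rfl⟩ := Subgroup.exists_list_map_prod_eq (fun k hk => by
      refine ⟨k⁻¹, inv_mem_displacementBall hk, ?_⟩
      have hinvT := hsmall _ (inv_mem_displacementBall hk)
      rw [eq_inv_iff_mul_eq_one, ← hgen1, ← tableGen_mul _ hinvT _ (hsmall k hk),
        classOf_inv π hk.1, inv_mul_cancel]
      rwa [classOf_inv π hk.1, inv_mul_cancel]) hx'
    have hAprod : A.prod ∈ K := K.list_prod_mem fun k hk => (hA k hk).1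
    have hmap : A.map (Φ ∘ fun k => tableGen T (classOf π k)) = A.map (classOf π) :=
      List.map_congr_left fun k hk => hΦgen _ (hsmall k (hA k hk))
    rw [map_list_prod, List.map_map, hmap, ← classOf_list_prod π fun k hk => (hA k hk).1,
      hker _ hAprod, ← hgen] at hx
    -- A word of trivial class is a product of elements of `K'(q, R)`. Their generators in the
    -- presented group are trivial, and so is the word.
    obtain ⟨B, hB, hBA⟩ := exists_list_of_mem_closure_displacementBall hx
    rw [map_classOf_prod_eq_of_prod_eq hfine hC hcob hl tableGen_mul
      (fun k hk => ⟨(hA k hk).1, (hA k hk).2.trans (by linarith)⟩)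
      (fun k hk => ⟨hK'K (hB k hk).1, (hB k hk).2.trans hRl⟩) hBA.symm]
    refine List.prod_eq_one fun y hy => ?_
    obtain ⟨k, hk, rfl⟩ := List.mem_map.1 hy
    rw [(hker k (hK'K (hB k hk).1)).2 (hB k hk).1, hgen1]
  have hsurj : Function.Surjective Φ := by
    intro γ
    obtain ⟨⟨k, hk⟩, rfl⟩ := hπ γ
    rw [← classOf_of_mem π hk, ← MonoidHom.mem_range]
    refine chain_induction hY hC hcobY (r := dist (k q) q)
      (P := fun k => classOf π k ∈ Φ.range) ?_ ?_ k hk le_rfl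
    · exact fun k hk hkq => ⟨_, hΦgen _ (hsmall k ⟨hk, hkq⟩)⟩
    · intro u hu v hv _ hvr _ ih
      rw [classOf_mul π hu hv]
      exact Subgroup.mul_mem _ ih ⟨_, hΦgen _ (hsmall v ⟨hv, hvr⟩)⟩
  exact ⟨MulEquiv.ofBijective Φ ⟨hinj, hsurj⟩, hΦ⟩

/-! ### Kernels of the class homomorphisms and their generators -/

/-- The kernel of a homomorphism defined on a subgroup, as a subgroup of the ambient group. -/
def kernelIn {A Γ : Type*} [Group A] [Group Γ] {G : Subgroup A} (ρ : G →* Γ) : Subgroup A :=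
  ρ.ker.map G.subtype

theorem mem_kernelIn {A Γ : Type*} [Group A] [Group Γ] {G : Subgroup A} {ρ : G →* Γ} {g : A} :
    g ∈ kernelIn ρ ↔ g ∈ G ∧ classOf ρ g = 1 := by
  rw [kernelIn, Subgroup.mem_map]
  constructor
  · rintro ⟨x, hx, rfl⟩
    exact ⟨x.2, (classOf_of_mem ρ x.2).trans hx⟩
  · rintro ⟨hg, h⟩
    rw [classOf_of_mem ρ hg] at h
    exact ⟨⟨g, hg⟩, h, rfl⟩

theorem kernelIn_subgroupOf {A Γ : Type*} [Group A] [Group Γ] {G : Subgroup A} (ρ : G →* Γ) :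
    (kernelIn ρ).subgroupOf G = ρ.ker :=
  Subgroup.comap_map_eq_self_of_injective G.subtype_injective ρ.ker

namespace IsFineApprox

variable {X Y Γ : Type*} [MetricSpace X] [MetricSpace Y] [Group Γ] {ε : ℝ}
  {p : X} {G : Subgroup (X ≃ᵢ X)} {q : Y} {K : Subgroup (Y ≃ᵢ Y)}
  {f : X → Y} {φ : (X ≃ᵢ X) → (Y ≃ᵢ Y)} {ψ : (Y ≃ᵢ Y) → (X ≃ᵢ X)}
  {π : K →* Γ} {L l : ℝ}

/-- A homomorphism that agrees with the classes of the approximation on small displacements does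
so on the whole domain of the approximation. -/
theorem classOf_eq_of_small (h : IsFineApprox ε p G q K f φ ψ π L l) {C : ℝ} (hC : 0 < C)
    (hcob : ∀ x, ∃ g ∈ G, dist (g p) x < C) (hl : 2 * C + 1 ≤ l) {ρ : G →* Γ}
    (hρ : ∀ g ∈ G, dist (g p) p ≤ 2 * C + 1 → classOf ρ g = classOf π (φ g)) :
    ∀ g ∈ G, dist (g p) p ≤ 1 / ε → classOf ρ g = classOf π (φ g) := by
  refine chain_induction h.geodesic hC hcob hρ fun u hu v hv hur hvr huv ih => ?_
  rw [classOf_mul ρ hu hv, h.classOf_φ_mul hu hv hur (by linarith) huv, ih, hρ v hv hvr]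

theorem classOf_ψ (h : IsFineApprox ε p G q K f φ ψ π L l) (hl : 0 ≤ l) {ρ : G →* Γ}
    (hρ : ∀ g ∈ G, dist (g p) p ≤ 1 / ε → classOf ρ g = classOf π (φ g)) {k : Y ≃ᵢ Y}
    (hk : k ∈ K) (hkq : dist (k q) q ≤ 1 / ε) : classOf ρ (ψ k) = classOf π k := by
  rw [hρ _ (h.ψ_mem hk hkq) (h.dist_ψ_le_radius hk hkq), h.classOf_φ_ψ hl hk hkq]

/-- The word `A` lifts to a product w of kernel elements of displacement at most `R + 5 * ε`. The
remainder w⁻¹ g is in the kernel and has displacement at most `δ`: `η` from the hypothesis,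
`A.length * ε` from the word, and `2 * ε` from equivariance and distortion. -/
theorem mem_closure_of_dist_prod_lt (h : IsFineApprox ε p G q K f φ ψ π L l) {ρ : G →* Γ}
    (hρ : ∀ g ∈ G, dist (g p) p ≤ 1 / ε → classOf ρ g = classOf π (φ g))
    {K' : Subgroup (Y ≃ᵢ Y)} (hK'K : K' ≤ K) (hker : ∀ k ∈ K, classOf π k = 1 ↔ k ∈ K')
    {R η δ : ℝ} (hR : 0 ≤ R) {A : List (Y ≃ᵢ Y)} (hA : ∀ k ∈ A, k ∈ displacementBall K' q R)
    (hlen : (A.length + 1) * (R + 1) ≤ l) (hδ : 5 * ε ≤ δ) (hηδ : (A.length + 2) * ε + η ≤ δ)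
    {g : X ≃ᵢ X} (hg : g ∈ kernelIn ρ) (hgp : dist (g p) p ≤ l)
    (hgA : dist (φ g q) (A.prod q) < η) :
    g ∈ Subgroup.closure (displacementBall (kernelIn ρ) p (R + δ)) := by
  have hr := h.le_radius
  have hL := h.L_pos
  have hl : 0 ≤ l := dist_nonneg.trans hgp
  have hAR : 0 ≤ (A.length : ℝ) * (R + 1) := by positivity
  obtain ⟨hAK, hAG, hAd, hAf, -⟩ :=
    h.list_prod_ψ A (fun k hk => ⟨hK'K (hA k hk).1, (hA k hk).2⟩) hlen hR
  have hw : ∀ x ∈ A.map ψ, x ∈ displacementBall (kernelIn ρ) p (R + δ) := by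
    intro x hx
    obtain ⟨k, hk, rfl⟩ := List.mem_map.1 hx
    have hkK := hK'K (hA k hk).1
    have hkr : dist (k q) q ≤ 1 / ε := by linarith [(hA k hk).2]
    refine ⟨mem_kernelIn.2 ⟨h.ψ_mem hkK hkr, ?_⟩, ?_⟩
    · rw [h.classOf_ψ hl hρ hkK hkr]
      exact (hker k hkK).2 (hA k hk).1
    · linarith [h.dist_ψ_le hkK hkr, (hA k hk).2]
  have hwN : (A.map ψ).prod ∈ kernelIn ρ :=
    Subgroup.list_prod_mem _ fun x hx => (hw x hx).1
  rw [← mul_inv_cancel_left (A.map ψ).prod g]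
  refine Subgroup.mul_mem _ (Subgroup.list_prod_mem _ fun x hx => Subgroup.subset_closure (hw x hx))
    (Subgroup.subset_closure ⟨Subgroup.mul_mem _ (Subgroup.inv_mem _ hwN) hg, ?_⟩)
  rw [IsometryEquiv.dist_inv_mul_apply]
  have hgr : dist (g p) p < 1 / ε := by linarith
  have e := h.approx.equivariant_φ g ⟨(mem_kernelIn.1 hg).1, hgr.le⟩ p h.base_mem
    (mem_ball.2 hgr)
  rw [h.approx.map_base] at e
  have hd := h.dist_le_map (x := g p) (y := (A.map ψ).prod p) (mem_ball.2 hgr)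
    (by rw [mem_ball]; linarith)
  have t1 := dist_triangle_left (f (g p)) (A.prod q) (φ g q)
  have t2 := dist_triangle_right (f (g p)) (f ((A.map ψ).prod p)) (A.prod q)
  linarith

/-- The kernel is generated by its elements of small displacement as soon as these generate the
elements of a fixed larger displacement. -/
theorem closure_kernelIn_eq (h : IsFineApprox ε p G q K f φ ψ π L l) {C : ℝ} (hC : 0 < C)
    (hcob : ∀ x, ∃ g ∈ G, dist (g p) x < C) {ρ : G →* Γ}
    (hρ : ∀ g ∈ G, dist (g p) p ≤ 1 / ε → classOf ρ g = classOf π (φ g))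
    {M : ℝ} (hMC : 2 * C + 2 ≤ M) (hMl : M ≤ l)
    {Φ : PresentedGroup (tableRelators (classOf π '' displacementBall K q M)) ≃* Γ}
    (hΦ : ∀ t, Φ (PresentedGroup.of t) = t) {s l₁ : ℝ} (hl₁ : 3 * (M + 1) ≤ l₁)
    (hsl₁ : 2 * (2 * C + 1) + s ≤ l₁)
    (hsmall : ∀ g ∈ kernelIn ρ, dist (g p) p ≤ l₁ →
      g ∈ Subgroup.closure (displacementBall (kernelIn ρ) p s)) :
    Subgroup.closure (displacementBall (kernelIn ρ) p s) = kernelIn ρ := by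
  set S := Subgroup.closure (displacementBall (kernelIn ρ) p s) with hS
  have hSN : S ≤ kernelIn ρ := (Subgroup.closure_le _).2 fun g hg => hg.1
  refine le_antisymm hSN ?_
  have hr := h.le_radius
  have hL := h.L_pos
  have hmul : ∀ a b : X ≃ᵢ X, dist ((a * b) p) p ≤ dist (a p) p + dist (b p) p :=
    fun a b => a.dist_mul_apply_le b p
  have hinv : ∀ a : X ≃ᵢ X, dist (a⁻¹ p) p = dist (a p) p := fun a => by
    rw [IsometryEquiv.dist_inv_apply, dist_comm]
  -- The conjugate of a generator has displacement at most `2 * (2 * C + 1) + s`, which is where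
  -- `hsl₁` enters.
  have hconj₁ : ∀ g ∈ G, dist (g p) p ≤ 2 * C + 1 → ∀ n ∈ S, g * n * g⁻¹ ∈ S := by
    intro g hg hgp n hn
    induction hn using Subgroup.closure_induction with
    | mem n hn =>
      have hnG := mem_kernelIn.1 hn.1
      refine hsmall _ (mem_kernelIn.2 ⟨G.mul_mem (G.mul_mem hg hnG.1) (G.inv_mem hg), ?_⟩) ?_
      · rw [classOf_mul ρ (G.mul_mem hg hnG.1) (G.inv_mem hg), classOf_mul ρ hg hnG.1,
          classOf_inv ρ hg, hnG.2, mul_one, mul_inv_cancel]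
      · linarith [hmul (g * n) g⁻¹, hmul g n, hinv g, hn.2]
    | one => simp
    | mul a b _ _ iha ihb =>
      rw [show g * (a * b) * g⁻¹ = g * a * g⁻¹ * (g * b * g⁻¹) by group]
      exact S.mul_mem iha ihb
    | inv a _ ih =>
      rw [show g * a⁻¹ * g⁻¹ = (g * a * g⁻¹)⁻¹ by group]
      exact S.inv_mem ih
  have hconj : ∀ g ∈ G, ∀ n ∈ S, g * n * g⁻¹ ∈ S := fun g hg =>
    chain_induction h.geodesic hC hcob (r := dist (g p) p)
      (P := fun g => ∀ n ∈ S, g * n * g⁻¹ ∈ S) hconj₁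
      (fun u _ v hv _ hvr _ ih n hn => by
        rw [show u * v * n * (u * v)⁻¹ = u * (v * n * v⁻¹) * u⁻¹ by group]
        exact ih _ (hconj₁ v hv hvr n hn)) g hg le_rfl
  have hnormal : (S.subgroupOf G).Normal := ⟨fun n hn g => hconj g g.2 n hn⟩
  -- Lifts of table elements have displacement at most `M + 1`; outside the table the value 1 is a
  -- default.
  have hlift : ∀ t : Γ, ∃ g : G, t ∈ classOf π '' displacementBall K q M →
      dist ((g : X ≃ᵢ X) p) p ≤ M + 1 ∧ ρ g = t := by
    intro t
    by_cases ht : t ∈ classOf π '' displacementBall K q M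
    · obtain ⟨k, ⟨hk, hkq⟩, rfl⟩ := ht
      have hkr : dist (k q) q ≤ 1 / ε := by linarith
      refine ⟨⟨ψ k, h.ψ_mem hk hkr⟩, fun _ => ⟨?_, ?_⟩⟩
      · change dist (ψ k p) p ≤ M + 1
        linarith [h.dist_ψ_le_add_half hk hkr]
      · rw [← classOf_of_mem, h.classOf_ψ (by linarith) hρ hk hkr]
    · exact ⟨1, fun h => absurd h ht⟩
  choose g hg using hlift
  have hmk : ∀ a b : G, ρ a = ρ b →
      dist ((a : X ≃ᵢ X) p) p + dist ((b : X ≃ᵢ X) p) p ≤ l₁ →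
      (a : G ⧸ S.subgroupOf G) = b := by
    intro a b hab hd
    rw [QuotientGroup.eq]
    refine hsmall _ (mem_kernelIn.2 ⟨(a⁻¹ * b).2, ?_⟩) ?_
    · change classOf ρ ((a⁻¹ * b : G) : X ≃ᵢ X) = 1
      rw [classOf_of_mem ρ (a⁻¹ * b).2]
      change ρ (a⁻¹ * b) = 1
      rw [map_mul, map_inv, hab, inv_mul_cancel]
    · have := hmul (a : X ≃ᵢ X)⁻¹ b
      rw [hinv] at this
      exact this.trans hd
  -- A table relation involves three lifts, so its defect is a kernel element of displacement at
  -- most `3 * (M + 1)` and lies in `S`.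
  obtain ⟨Θ', hΘ'⟩ := exists_tablePresented_hom
    (T := classOf π '' displacementBall K q M) (fun t => (g t : G ⧸ S.subgroupOf G))
    fun a ha b hb hab => by
      rw [← QuotientGroup.mk_mul]
      refine hmk _ _ ?_ ?_
      · rw [map_mul, (hg _ ha).2, (hg _ hb).2, (hg _ hab).2]
      · have := hmul (g a : X ≃ᵢ X) (g b)
        have h1 := (hg _ ha).1
        have h2 := (hg _ hb).1
        have h3 := (hg _ hab).1
        rw [Subgroup.coe_mul]
        linarith
  have hΘ : ∀ t (ht : t ∈ classOf π '' displacementBall K q M),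
      Θ' (Φ.symm t) = (g t : G ⧸ S.subgroupOf G) := by
    intro t ht
    rw [← hΘ' ⟨t, ht⟩]
    congr 1
    rw [MulEquiv.symm_apply_eq, hΦ]
  have hcomp₁ : ∀ a : G, dist ((a : X ≃ᵢ X) p) p ≤ 2 * C + 1 →
      Θ' (Φ.symm (ρ a)) = (a : G ⧸ S.subgroupOf G) := by
    intro a ha
    have hρa := hρ a a.2 (by linarith)
    have haT : ρ a ∈ classOf π '' displacementBall K q M := by
      refine ⟨φ a, ⟨h.φ_mem a.2 (by linarith), ?_⟩, ?_⟩
      · linarith [h.dist_φ_le a.2 (by linarith)]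
      · rw [← hρa, classOf_of_mem ρ a.2]
    rw [hΘ _ haT]
    exact hmk _ _ (hg _ haT).2 (by linarith [(hg _ haT).1])
  -- The projection to the quotient by `S` factors through `ρ`, which forces the kernel of `ρ` into
  -- `S`.
  have hcomp : ∀ a ∈ G, ∀ ha : a ∈ G,
      Θ' (Φ.symm (ρ ⟨a, ha⟩)) = ((⟨a, ha⟩ : G) : G ⧸ S.subgroupOf G) := fun a ha =>
    chain_induction h.geodesic hC hcob (r := dist (a p) p)
      (P := fun a => ∀ ha : a ∈ G,
        Θ' (Φ.symm (ρ ⟨a, ha⟩)) = ((⟨a, ha⟩ : G) : G ⧸ S.subgroupOf G))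
      (fun a _ hap ha => hcomp₁ ⟨a, ha⟩ hap)
      (fun u hu v hv _ hvr _ ih huv => by
        have : (⟨u * v, huv⟩ : G) = ⟨u, hu⟩ * ⟨v, hv⟩ := rfl
        rw [this, map_mul, map_mul, map_mul, ih hu, hcomp₁ ⟨v, hv⟩ hvr, QuotientGroup.mk_mul])
      a ha le_rfl
  intro a ha
  obtain ⟨haG, ha1⟩ := mem_kernelIn.1 ha
  have := hcomp a haG haG
  rw [← classOf_of_mem ρ haG, ha1, map_one, map_one, eq_comm, QuotientGroup.eq_one_iff] at this
  exact this

end IsFineApprox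

/-- Eventually all elements of the kernels of bounded displacement are products of elements whose
displacement almost satisfies the bound for the generators of the limit. -/
theorem eventually_mem_closure {X : ℕ → Type*} [∀ i, MetricSpace (X i)] {Y Γ : Type*}
    [MetricSpace Y] [ProperSpace Y] [Group Γ] {ε : ℕ → ℝ} {p : ∀ i, X i}
    {G : ∀ i, Subgroup (X i ≃ᵢ X i)} {q : Y} {K K' : Subgroup (Y ≃ᵢ Y)} {f : ∀ i, X i → Y}
    {φ : ∀ i, (X i ≃ᵢ X i) → (Y ≃ᵢ Y)} {ψ : ∀ i, (Y ≃ᵢ Y) → (X i ≃ᵢ X i)} {π : K →* Γ} {L : ℝ}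
    (hε : Tendsto ε atTop (𝓝 0))
    (hfine : ∀ l, ∀ᶠ i in atTop,
      IsFineApprox (ε i) (p i) (G i) q K (f i) (φ i) (ψ i) π L l)
    (hK'K : K' ≤ K) (hker : ∀ k ∈ K, classOf π k = 1 ↔ k ∈ K') {R : ℝ} (hR : 0 ≤ R)
    (hgen : Subgroup.closure (displacementBall K' q R) = K') (l₁ : ℝ) {δ : ℝ} (hδ : 0 < δ) :
    ∀ᶠ i in atTop, ∀ ρ : G i →* Γ,
      (∀ g ∈ G i, dist (g (p i)) (p i) ≤ 1 / ε i → classOf ρ g = classOf π (φ i g)) →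
      ∀ g ∈ kernelIn ρ, dist (g (p i)) (p i) ≤ l₁ →
        g ∈ Subgroup.closure (displacementBall (kernelIn ρ) (p i) (R + δ)) := by
  -- Half of `δ` is spent on the net. The other half absorbs errors proportional to the lengths of
  -- the finitely many words.
  obtain ⟨F, hFK, hF, happrox⟩ := exists_finite_orbit_approx (η := δ / 2) (by positivity)
    (fun k (hk : k ∈ displacementBall K' q (l₁ + 1)) => hk.2)
  have hFev : ∀ k ∈ F, ∀ᶠ i in atTop, ∀ ρ : G i →* Γ,
      (∀ g ∈ G i, dist (g (p i)) (p i) ≤ 1 / ε i → classOf ρ g = classOf π (φ i g)) →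
      ∀ g ∈ kernelIn ρ, dist (g (p i)) (p i) ≤ l₁ → dist (φ i g q) (k q) < δ / 2 →
        g ∈ Subgroup.closure (displacementBall (kernelIn ρ) (p i) (R + δ)) := by
    intro k hk
    have hkgen := (hFK hk).1
    rw [← hgen] at hkgen
    obtain ⟨A, hA, rfl⟩ := exists_list_of_mem_closure_displacementBall hkgen
    have h5 : ∀ᶠ i in atTop, ε i < δ / 5 := hε.eventually_lt_const (by positivity)
    have hA2 : ∀ᶠ i in atTop, ε i < δ / 2 / (A.length + 2) :=
      hε.eventually_lt_const (by positivity)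
    filter_upwards [hfine (max l₁ ((A.length + 1) * (R + 1))), h5, hA2] with
      i h h5 hA2 ρ hρ g hg hgp hgA
    rw [lt_div_iff₀ (by positivity)] at hA2
    exact h.mem_closure_of_dist_prod_lt hρ hK'K hker hR hA (le_max_right _ _) (by linarith)
      (by linarith) hg (hgp.trans (le_max_left _ _)) hgA
  filter_upwards [(eventually_all_finite hF).2 hFev, hfine (max l₁ 0)] with i hi h ρ hρ g hg hgp
  have hr := h.le_radius
  have hL := h.L_pos
  have hm := le_max_left l₁ 0
  have hm' := le_max_right l₁ 0
  obtain ⟨hgG, hg1⟩ := mem_kernelIn.1 hg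
  have hφK := h.φ_mem hgG (by linarith)
  obtain ⟨k, hk, hgk⟩ := happrox (φ i g) ⟨(hker _ hφK).1 ((hρ g hgG (by linarith)).symm.trans hg1),
    by linarith [h.dist_φ_le hgG (by linarith)]⟩
  exact hi k hk ρ hρ g hg hgp hgk

namespace IsFineApprox

variable {X Y Γ : Type*} [MetricSpace X] [MetricSpace Y] [Group Γ] {ε : ℝ}
  {p : X} {G : Subgroup (X ≃ᵢ X)} {q : Y} {K : Subgroup (Y ≃ᵢ Y)}
  {f : X → Y} {φ : (X ≃ᵢ X) → (Y ≃ᵢ Y)} {ψ : (Y ≃ᵢ Y) → (X ≃ᵢ X)}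
  {π : K →* Γ} {L l : ℝ}

/-- Elements of `G` that are `ε`-close to the identity on a fixed ball have trivial class, so a
limit of kernel elements differs from one of them by a kernel element. -/
theorem isClosed_kernelIn [ProperSpace X] (h : IsFineApprox ε p G q K f φ ψ π L l) (hl : 0 ≤ l)
    {ρ : G →* Γ}
    (hρ : ∀ g ∈ G, dist (g p) p ≤ 1 / ε → classOf ρ g = classOf π (φ g))
    (hG : IsClosed (G : Set (X ≃ᵢ X))) : IsClosed (kernelIn ρ : Set (X ≃ᵢ X)) := by
  have hL := h.L_pos
  refine isClosed_of_closure_subset fun g hg => ?_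
  have hgG : g ∈ G := hG.closure_subset_iff.2 (fun x hx => (mem_kernelIn.1 hx).1) hg
  obtain ⟨k, hk, hkN⟩ := mem_closure_iff_nhds.1 hg _ ((IsometryEquiv.nhds_hasBasis g).mem_of_mem
    (i := (closedBall p (L + 1), ε)) ⟨isCompact_closedBall p (L + 1), h.approx.pos⟩)
  obtain ⟨hkG, hk1⟩ := mem_kernelIn.1 hkN
  have hclose : ∀ x ∈ ball p (L + 1), dist ((k⁻¹ * g) x) x < ε := fun x hx => by
    rw [IsometryEquiv.dist_inv_mul_apply, dist_comm]
    exact hk x (ball_subset_closedBall hx)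
  have hkg := G.mul_mem (G.inv_mem hkG) hgG
  have hkgp := hclose p (mem_ball_self (by linarith))
  have h1 := hρ _ hkg (by linarith [h.ten_le_radius, h.le_tenth])
  rw [h.classOf_φ_eq_one hl hkg hclose, classOf_mul ρ (G.inv_mem hkG) hgG, classOf_inv ρ hkG, hk1,
    inv_one, one_mul] at h1
  exact mem_kernelIn.2 ⟨hgG, h1⟩

/-- Both `φ` and `ψ` preserve classes up to displacement 1 / ε, so they restrict to the kernels
unchanged. -/
theorem approx_kernelIn (h : IsFineApprox ε p G q K f φ ψ π L l) (hl : 0 ≤ l) {ρ : G →* Γ}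
    (hρ : ∀ g ∈ G, dist (g p) p ≤ 1 / ε → classOf ρ g = classOf π (φ g))
    {K' : Subgroup (Y ≃ᵢ Y)} (hK'K : K' ≤ K) (hker : ∀ k ∈ K, classOf π k = 1 ↔ k ∈ K') :
    IsEGHApprox ε p (kernelIn ρ) q K' f φ ψ where
  pos := h.approx.pos
  mapsTo_f := h.approx.mapsTo_f
  mapsTo_φ g hg := by
    obtain ⟨hgG, hg1⟩ := mem_kernelIn.1 hg.1
    have hφ := h.approx.mapsTo_φ ⟨hgG, hg.2⟩
    exact ⟨(hker _ hφ.1).1 ((hρ g hgG hg.2).symm.trans hg1), hφ.2⟩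
  mapsTo_ψ k hk := by
    have hkK := hK'K hk.1
    have hψ := h.approx.mapsTo_ψ ⟨hkK, hk.2⟩
    exact ⟨mem_kernelIn.2 ⟨hψ.1, (h.classOf_ψ hl hρ hkK hk.2).trans ((hker k hkK).2 hk.1)⟩, hψ.2⟩
  map_base := h.approx.map_base
  dense := h.approx.dense
  distortion := h.approx.distortion
  equivariant_φ g hg := h.approx.equivariant_φ g ⟨(mem_kernelIn.1 hg.1).1, hg.2⟩
  equivariant_ψ k hk := h.approx.equivariant_ψ k ⟨hK'K hk.1, hk.2⟩

theorem surjective (h : IsFineApprox ε p G q K f φ ψ π L l) {ρ : G →* Γ}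
    (hρ : ∀ g ∈ G, dist (g p) p ≤ 1 / ε → classOf ρ g = classOf π (φ g))
    (hπ : Function.Surjective π) (hY : IsGeodesicSpace Y) {C : ℝ} (hC : 0 < C)
    (hcobY : ∀ y, ∃ k ∈ K, dist (k q) y < C) (hl : 2 * C + 1 ≤ l) : Function.Surjective ρ := by
  have hr := h.le_radius
  have hL := h.L_pos
  intro γ
  obtain ⟨⟨k, hk⟩, rfl⟩ := hπ γ
  have hbase : ∀ k ∈ K, dist (k q) q ≤ 2 * C + 1 → classOf π k ∈ ρ.range := fun k hk hkq => by
    have hkr : dist (k q) q ≤ 1 / ε := by linarith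
    rw [← h.classOf_ψ (by linarith) hρ hk hkr, classOf_of_mem ρ (h.ψ_mem hk hkr)]
    exact ⟨_, rfl⟩
  rw [← classOf_of_mem π hk, ← MonoidHom.mem_range]
  refine chain_induction hY hC hcobY (r := dist (k q) q)
    (P := fun k => classOf π k ∈ ρ.range) hbase (fun u hu v hv _ hvr _ ih => ?_) k hk le_rfl
  rw [classOf_mul π hu hv]
  exact Subgroup.mul_mem _ ih (hbase v hv hvr)

end IsFineApprox

/-! ### Choice of the subgroups and proof of the theorem -/

/-- Take the largest n ≤ i with `P n i`; no monotonicity is needed. It turns generation for each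
fixed error into one sequence of errors tending to 0. -/
theorem exists_diagonal {P : ℕ → ℕ → Prop} (hP : ∀ n, ∀ᶠ i in atTop, P n i)
    (h0 : ∀ i, P 0 i) : ∃ m : ℕ → ℕ, Tendsto m atTop atTop ∧ ∀ i, P (m i) i := by
  classical
  refine ⟨fun i => Nat.findGreatest (P · i) i, tendsto_atTop.2 fun n => ?_, fun i =>
    Nat.findGreatest_spec (P := (P · i)) (Nat.zero_le i) (h0 i)⟩
  filter_upwards [hP n, eventually_ge_atTop n] with i hi hn
  exact Nat.le_findGreatest hn hi

theorem closure_displacementBall_bot {X : Type*} [MetricSpace X] (p : X) (r : ℝ) :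
    Subgroup.closure (displacementBall (⊥ : Subgroup (X ≃ᵢ X)) p r) = ⊥ :=
  le_bot_iff.1 ((Subgroup.closure_le _).2 fun _ hg => hg.1)

instance isometryGroupT1Space (X : Type*) [MetricSpace X] : T1Space (X ≃ᵢ X) := by
  refine ⟨fun g => isClosed_of_closure_subset fun h hh => ?_⟩
  rw [mem_singleton_iff]
  ext x
  by_contra hne
  obtain ⟨k, hk, rfl⟩ := mem_closure_iff_nhds.1 hh _ ((IsometryEquiv.nhds_hasBasis h).mem_of_mem
    (i := ({x}, dist (h x) (g x))) ⟨isCompact_singleton, dist_pos.2 hne⟩)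
  have := hk x rfl
  rw [dist_comm] at this
  exact lt_irrefl _ this

theorem mainTheorem5
    (X : ℕ → Type*) [∀ i, MetricSpace (X i)] [∀ i, ProperSpace (X i)]
    [∀ i, SimplyConnectedSpace (X i)] (hX : ∀ i, IsGeodesicSpace (X i))
    (p : ∀ i, X i)
    (G : ∀ i, Subgroup (X i ≃ᵢ X i)) (hG : ∀ i, IsClosed (G i : Set (X i ≃ᵢ X i)))
    (D : ℝ) (hD : ∀ i, orbitSpaceDiam (G i) < ENNReal.ofReal D)
    (Y : Type*) [MetricSpace Y] [ProperSpace Y] (hY : IsGeodesicSpace Y) (q : Y)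
    (K : Subgroup (Y ≃ᵢ Y)) (hK : IsClosed (K : Set (Y ≃ᵢ Y)))
    (f : ∀ i, X i → Y) (hf : EGHConvergesVia p G q K f)
    (K' : Subgroup (Y ≃ᵢ Y)) (hK'K : K' ≤ K) [(K'.subgroupOf K).Normal]
    (hK' : IsClosed (K' : Set (Y ≃ᵢ Y)))
    (hdisc : DiscreteTopology (K ⧸ K'.subgroupOf K))
    (R : ℝ) (hR : 0 ≤ R) (hgen : Subgroup.closure (displacementBall K' q R) = K') :
    (∃ (G' : ∀ i, Subgroup (X i ≃ᵢ X i)) (_ : ∀ i, ((G' i).subgroupOf (G i)).Normal),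
      (∀ i, G' i ≤ G i) ∧
      (∀ i, IsClosed (G' i : Set (X i ≃ᵢ X i))) ∧
      EGHPairConvergesVia p G G' q K K' f ∧
      (∀ᶠ i in atTop,
        Nonempty ((G i ⧸ (G' i).subgroupOf (G i)) ≃* (K ⧸ K'.subgroupOf K))) ∧
      (∃ ε : ℕ → ℝ, Tendsto ε atTop (𝓝 0) ∧
        ∀ i, Subgroup.closure (displacementBall (G' i) (p i) (R + ε i)) = G' i)) ∧
    Group.IsFinitelyPresented (K ⧸ K'.subgroupOf K) := by
  have hD0 : 0 < D := by
    by_contra hneg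
    have := hD 0
    rw [ENNReal.ofReal_of_nonpos (not_lt.1 hneg)] at this
    exact not_lt_bot this
  have hcobD : ∀ i x, ∃ g ∈ G i, dist (g (p i)) x < D := fun i x =>
    exists_dist_lt_of_orbitSpaceDiam_lt (hD i) (p i) x
  have hcobY := hf.cobounded hcobD
  have hC : 0 < D + 1 := by linarith
  -- The constant `D + 1` serves for the spaces and for the limit.
  have hcob : ∀ i x, ∃ g ∈ G i, dist (g (p i)) x < D + 1 := fun i x => by
    obtain ⟨g, hg, hgx⟩ := hcobD i x
    exact ⟨g, hg, hgx.trans (by linarith)⟩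
  generalize D + 1 = C at hcobY hC hcob
  let π : K →* K ⧸ K'.subgroupOf K := QuotientGroup.mk' _
  have hπ : Function.Surjective π := QuotientGroup.mk'_surjective _
  have hker : ∀ k ∈ K, classOf π k = 1 ↔ k ∈ K' := fun k hk => by
    rw [classOf_of_mem π hk]
    exact (QuotientGroup.eq_one_iff _).trans Subgroup.mem_subgroupOf
  have hopen : IsOpen (K'.subgroupOf K : Set K) := by
    have hpre : (K'.subgroupOf K : Set K) = QuotientGroup.mk ⁻¹' {(1 : K ⧸ K'.subgroupOf K)} := by
      ext k
      exact (QuotientGroup.eq_one_iff k).symm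
    rw [hpre]
    exact (isOpen_discrete _).preimage QuotientGroup.continuous_mk
  obtain ⟨L, hL, η, hη, hsep'⟩ := exists_separated hopen hcobY
  have hsep : ∀ k₁ ∈ K, ∀ k₂ ∈ K, ∀ z : Y, (∀ y ∈ ball z L, dist (k₁ y) (k₂ y) < η) →
      classOf π k₁ = classOf π k₂ := fun k₁ hk₁ k₂ hk₂ z hz => by
    have := (hker _ (K.mul_mem (K.inv_mem hk₁) hk₂)).2 (hsep' k₁ hk₁ k₂ hk₂ z hz)
    rwa [classOf_mul π (K.inv_mem hk₁) hk₂, classOf_inv π hk₁, inv_mul_eq_one] at this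
  obtain ⟨ε, hε, hev⟩ := hf
  have hchoice : ∀ i, ∃ φψ : ((X i ≃ᵢ X i) → (Y ≃ᵢ Y)) × ((Y ≃ᵢ Y) → (X i ≃ᵢ X i)),
      (∃ φ ψ, IsEGHApprox (ε i) (p i) (G i) q K (f i) φ ψ) →
        IsEGHApprox (ε i) (p i) (G i) q K (f i) φψ.1 φψ.2 := fun i => by
    by_cases h : ∃ φ ψ, IsEGHApprox (ε i) (p i) (G i) q K (f i) φ ψ
    · obtain ⟨φ, ψ, h⟩ := h
      exact ⟨(φ, ψ), fun _ => h⟩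
    · exact ⟨(fun _ => 1, fun _ => 1), fun h' => absurd h' h⟩
  choose φψ hφψ using hchoice
  have hfine : ∀ l, ∀ᶠ i in atTop, IsFineApprox (ε i) (p i) (G i) q K (f i) (φψ i).1 (φψ i).2
      π L l := by
    intro l
    have h1 : ∀ᶠ i in atTop, ε i < η / 10 := hε.eventually_lt_const (by positivity)
    have h2 : ∀ᶠ i in atTop, ε i < 1 / 10 := hε.eventually_lt_const (by positivity)
    have h3 : ∀ᶠ i in atTop, ε i < 1 / (2 * (|l| + L + 1)) :=
      hε.eventually_lt_const (by positivity)
    filter_upwards [hev, h1, h2, h3] with i hi h1 h2 h3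
    have hA := hφψ i hi
    refine ⟨hA, hX i, hL, fun k₁ hk₁ k₂ hk₂ z hz => hsep k₁ hk₁ k₂ hk₂ z fun y hy =>
      (hz y hy).trans (by linarith), h2.le, ?_⟩
    have := (lt_one_div hA.pos (by positivity)).1 h3
    linarith [le_abs_self l]
  obtain ⟨l, hl⟩ : ∃ l, l = 3 * C + 2 + R := ⟨_, rfl⟩
  obtain ⟨Φ, hΦ⟩ := exists_tablePresented_mulEquiv hY hfine hC hcob hcobY (l := l)
    (by linarith) (by linarith : R ≤ l - 1) hπ hK'K hker hgen
  have hfin : (classOf π '' displacementBall K q (l + 1)).Finite :=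
    finite_image_of_separated hη (fun k hk => hk.2) fun k₁ hk₁ k₂ hk₂ h =>
      hsep k₁ hk₁.1 k₂ hk₂.1 q h
  refine ⟨?_, by
    have := hfin.to_subtype
    have := (finite_tableRelators hfin).to_subtype
    exact Group.IsFinitelyPresented.equiv Φ⟩
  -- With table radius `l + 1`, this covers the table defects `3 * (l + 2)` and the conjugates of
  -- generators of displacement at most `R + 1`.
  obtain ⟨l₁, hl₁⟩ : ∃ l₁, l₁ = 3 * (l + 2) + 2 * (2 * C + 1) + R + 1 := ⟨_, rfl⟩
  have hsmall := fun (δ : ℝ) (hδ : 0 < δ) =>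
    eventually_mem_closure hε hfine hK'K hker hR hgen l₁ hδ
  obtain ⟨i₀, hi₀⟩ := eventually_atTop.1 ((hfine (l + 1)).and (hsmall 1 one_pos))
  -- Before `i₀` the trivial subgroup satisfies all that is required for every index; from `i₀` on
  -- the kernel is taken, and `i₀` already ensures generation with error 1.
  have hN : ∀ i, ∃ N : Subgroup (X i ≃ᵢ X i), (i < i₀ → N = ⊥) ∧
      (i₀ ≤ i → ∃ ρ : G i →* K ⧸ K'.subgroupOf K, N = kernelIn ρ ∧
        ∀ g ∈ G i, dist (g (p i)) (p i) ≤ 1 / ε i →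
          classOf ρ g = classOf π ((φψ i).1 g)) := by
    intro i
    rcases lt_or_ge i i₀ with hi | hi
    · exact ⟨⊥, fun _ => rfl, fun h => absurd hi h.not_gt⟩
    · have h := (hi₀ i hi).1
      obtain ⟨ρ, hρ⟩ := h.exists_monoidHom hC (hcob i) (l := l) (by linarith) (by linarith)
        (θ := id) fun _ _ _ _ _ => rfl
      exact ⟨kernelIn ρ, fun h => absurd hi h.not_ge, fun _ => ⟨ρ, rfl,
        h.classOf_eq_of_small hC (hcob i) (by linarith) fun g hg hgp => hρ g hg (by linarith)⟩⟩
  choose N hNbot hNker using hN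
  have hgenδ : ∀ δ, δ ≤ 1 → ∀ i, i₀ ≤ i →
      (∀ ρ : G i →* K ⧸ K'.subgroupOf K, (∀ g ∈ G i, dist (g (p i)) (p i) ≤ 1 / ε i →
        classOf ρ g = classOf π ((φψ i).1 g)) → ∀ g ∈ kernelIn ρ, dist (g (p i)) (p i) ≤ l₁ →
          g ∈ Subgroup.closure (displacementBall (kernelIn ρ) (p i) (R + δ))) →
      Subgroup.closure (displacementBall (N i) (p i) (R + δ)) = N i := by
    intro δ hδ i hi hmem
    obtain ⟨ρ, hNρ, hρ⟩ := hNker i hi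
    rw [hNρ]
    exact (hi₀ i hi).1.closure_kernelIn_eq hC (hcob i) hρ (by linarith) le_rfl hΦ (l₁ := l₁)
      (by linarith) (by linarith) (hmem ρ hρ)
  have hnormal : ∀ i, ((N i).subgroupOf (G i)).Normal := fun i => by
    rcases lt_or_ge i i₀ with hi | hi
    · rw [hNbot i hi, Subgroup.bot_subgroupOf]
      infer_instance
    · obtain ⟨ρ, hNρ, -⟩ := hNker i hi
      rw [hNρ, kernelIn_subgroupOf]
      infer_instance
  refine ⟨N, hnormal, fun i => ?_, fun i => ?_, ⟨ε, hε, ?_⟩, ?_, ?_⟩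
  · rcases lt_or_ge i i₀ with hi | hi
    · rw [hNbot i hi]
      exact bot_le
    · obtain ⟨ρ, hNρ, -⟩ := hNker i hi
      rw [hNρ]
      exact fun g hg => (mem_kernelIn.1 hg).1
  · rcases lt_or_ge i i₀ with hi | hi
    · rw [hNbot i hi, Subgroup.coe_bot]
      exact isClosed_singleton
    · obtain ⟨ρ, hNρ, hρ⟩ := hNker i hi
      rw [hNρ]
      exact (hi₀ i hi).1.isClosed_kernelIn (by linarith) hρ (hG i)
  · filter_upwards [eventually_ge_atTop i₀] with i hi
    obtain ⟨ρ, hNρ, hρ⟩ := hNker i hi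
    have h := (hi₀ i hi).1
    rw [hNρ]
    exact ⟨_, _, h.approx, h.approx_kernelIn (by linarith) hρ hK'K hker⟩
  · filter_upwards [eventually_ge_atTop i₀] with i hi
    obtain ⟨ρ, hNρ, hρ⟩ := hNker i hi
    have hker' : (N i).subgroupOf (G i) = ρ.ker := by rw [hNρ, kernelIn_subgroupOf]
    exact ⟨(QuotientGroup.quotientMulEquivOfEq hker').trans
      (QuotientGroup.quotientKerEquivOfSurjective ρ
        ((hi₀ i hi).1.surjective hρ hπ hY hC hcobY (by linarith)))⟩
  -- The case n = 0 is error 1, which holds for every index by the choice of `i₀`.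
  · obtain ⟨m, hm, hmP⟩ := exists_diagonal
      (P := fun n i => Subgroup.closure
        (displacementBall (N i) (p i) (R + 1 / ((n : ℝ) + 1))) = N i)
      (fun n => by
        filter_upwards [eventually_ge_atTop i₀, hsmall _ (Nat.one_div_pos_of_nat (n := n))]
          with i hi hmem
        refine hgenδ _ ?_ i hi hmem
        rw [div_le_one (by positivity)]
        linarith [(Nat.cast_nonneg n : (0 : ℝ) ≤ n)])
      (fun i => by
        rcases lt_or_ge i i₀ with hi | hi
        · rw [hNbot i hi]
          exact closure_displacementBall_bot _ _
        · rw [Nat.cast_zero, zero_add, div_one]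
          exact hgenδ 1 le_rfl i hi (hi₀ i hi).2)
    exact ⟨fun i => 1 / ((m i : ℝ) + 1), tendsto_one_div_add_atTop_nhds_zero_nat.comp hm, hmP⟩

end
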